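/- Let $K$ be a non-Archimedean local field (a non-discrete, totally disconnected, locally compact field) with canonical absolute value $|\cdot|$ (the factor by which multiplication scales Haar measure), ring of integers $O$ and maximal ideal $P=\beta O$, where $\beta$ is a uniformizer. Let $q$ be the number of elements of $O/P$, let $S\subset O$ be a complete set of representatives for $O/P$, and put $B_r=\beta^{-r}O$ for $r\in\mathbf Z$. Let $\chi$ be a rank zero character of $K$, i.e. a continuous unitary additive character such that $0$ is the largest integer $r$ with $\chi|_{B_r}\equiv 1$. Fix real numbers $\alpha>0$ and $t>0$ and an integer $n>0$, and let $$X_n=\Big\{\sum_{i=-n}^{n-1}a_i\beta^i : a_i\in S\Big\}$$ be the canonical set of representatives for the group $B_n/B_{-n}$, with the group structure carried over from $B_n/B_{-n}$. Assume that $0\in X_n$ (this holds in particular if $0\in S$). For $s\ge 0$ and $x\in X_n$ put $$p_{s,n}(x)=q^{-n}\sum_{y\in X_n}e^{-s|y|^\alpha}\chi(xy).$$ Let $D[0,t]$ be the space of functions $\omega:[0,t]\to K$ that are right-continuous on $[0,t)$, have left limits on $(0,t]$ and satisfy $\omega(t)=\omega(t-0)$, equipped with the Borel sets of the Skorokhod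 topology. For $a\in X_n$ let $\mathbf P_a^n$ denote the probability measure on $D[0,t]$ such that, for all $N$, all $0\le t_1<\dots<t_N\le t$ and all Borel sets $J_1,\dots,J_N\subset K$, $$\mathbf P_a^n(\omega(t_i)\in J_i,\ 1\le i\le N)=\sum_{b_i\in J_i\cap X_n,\ 1\le i\le N}p_{t_1,n}(b_1-a)\,p_{t_2-t_1,n}(b_2-b_1)\cdots p_{t_N-t_{N-1},n}(b_N-b_{N-1})\,q^{-nN}.$$ Theorem. For each $a\in X_n$ such a probability measure $\mathbf P_a^n$ exists, and (every) such measure gives full measure to the paths on the grid, that is, $$\mathbf P_a^n\big(\omega : \omega(s)\in X_n\ \text{for all } s\in[0,t]\big)=1 .$$ -/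

import Mathlib

open scoped ValuativeRel Topology MeasureTheory

noncomputable section

namespace LocalFieldWalk

section Field

variable (K : Type*) [Field K] [ValuativeRel K] [TopologicalSpace K]
  [IsNonarchimedeanLocalField K]

/-- The number `q` of elements of the residue field `O/P`. -/
def resCard : ℕ := Nat.card 𝓀[K]

variable {K}

/-- The canonical absolute value: `|x|` is the factor by which multiplication by `x` scales
Haar measure on `K`, and `|0| = 0`. -/
def canonAbs (x : K) : ℝ :=
  open Classical in
  if h : x = 0 then 0 else (MeasureTheory.distribHaarChar K (Units.mk0 x h) : ℝ)

/-- `β` is a uniformizer: `P = βO`. -/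
def IsUniformizer (β : 𝒪[K]) : Prop := 𝓂[K] = Ideal.span {β}

/-- `S` is a complete set of representatives for the residue classes in `O/P`. -/
def IsRepSystem (S : Finset 𝒪[K]) : Prop :=
  Set.BijOn (IsLocalRing.residue 𝒪[K]) (S : Set 𝒪[K]) Set.univ

/-- The ball `B_r = β^{-r} O` (of radius `q^r`). -/
def ball (β : 𝒪[K]) (r : ℤ) : Set K := {x | ∃ y : 𝒪[K], x = (β : K) ^ (-r) * (y : K)}

/-- `χ` is a (continuous, unitary) additive character of `K` of rank zero: the largest integer `r`
with `χ = 1` on `B_r` is `0`. -/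
def IsRankZeroChar (β : 𝒪[K]) (χ : AddChar K Circle) : Prop :=
  Continuous χ ∧ IsGreatest {r : ℤ | ∀ x ∈ ball β r, χ x = 1} 0

/-- The grid `X_n`: all sums `a_{-n} β^{-n} + ⋯ + a_{n-1} β^{n-1}` with `a_i ∈ S`. -/
def grid (β : 𝒪[K]) (S : Finset 𝒪[K]) (n : ℕ) : Finset K :=
  open Classical in
  (Fintype.piFinset fun _ : Fin (2 * n) => S).image
    fun c => ∑ j : Fin (2 * n), (c j : K) * (β : K) ^ ((j : ℤ) - (n : ℤ))

/-- The inverse finite Fourier transform `q^{-n} ∑_{y ∈ X_n} f(y) χ(xy)`. It is written for all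
`x : K`; see `invFourier_add`. -/
def invFourier (β : 𝒪[K]) (S : Finset 𝒪[K]) (χ : AddChar K Circle) (n : ℕ) (f : K → ℂ) (x : K) :
    ℂ :=
  ((resCard K : ℂ) ^ n)⁻¹ * ∑ y ∈ grid β S n, f y * (χ (x * y) : ℂ)

/-- The density `p_{s,n}`, the inverse finite Fourier transform of `e^{-s|·|^α}`. -/
def density (β : 𝒪[K]) (S : Finset 𝒪[K]) (χ : AddChar K Circle) (α : ℝ) (n : ℕ) (s : ℝ) (x : K) :
    ℂ :=
  invFourier β S χ n (fun y => (Real.exp (-s * canonAbs y ^ α) : ℂ)) x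

/-- Inverse finite Fourier transforms are invariant under `H_n = B_{-n}`. Hence the value at the
difference of two grid points is the same whether that difference is taken in `K` or
in `X_n`, with the group structure carried over from `B_n / H_n`. -/
theorem invFourier_add {β : 𝒪[K]} (hβ : IsUniformizer β) (S : Finset 𝒪[K])
    {χ : AddChar K Circle} (hχ : IsRankZeroChar β χ) (n : ℕ) (f : K → ℂ) (x h : K)
    (hh : h ∈ ball β (-(n : ℤ))) :
    invFourier β S χ n f (x + h) = invFourier β S χ n f x := by
  classical
  have hβ0 : (β : K) ≠ 0 := by
    intro h0
    have h1 : β = 0 := Subtype.ext h0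
    have h2 : 𝓂[K] = ⊥ := by
      rw [IsUniformizer, h1] at hβ
      simpa using hβ
    exact IsDiscreteValuationRing.not_a_field 𝒪[K] h2
  unfold invFourier
  congr 1
  refine Finset.sum_congr rfl fun y hy => ?_
  have key : χ (h * y) = 1 := by
    obtain ⟨c, -, rfl⟩ := Finset.mem_image.1 hy
    obtain ⟨o, rfl⟩ := hh
    refine hχ.2.1 _ ⟨∑ j : Fin (2 * n), c j * β ^ (j : ℕ) * o, ?_⟩
    push_cast
    rw [Finset.mul_sum, neg_zero, zpow_zero, one_mul]
    refine Finset.sum_congr rfl fun j _ => ?_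
    rw [zpow_sub₀ hβ0, neg_neg, zpow_natCast, zpow_natCast]
    have := pow_ne_zero n hβ0
    field_simp
  rw [add_mul, AddChar.map_add_eq_mul, key, mul_one]

variable (K)

/-- The space `D[0,t]` of Skorokhod functions `[0,t] → K`. One-sided limits are taken within
`[0,t]`, so that the conditions on the right of `t` and on the left of `0` are void. -/
structure SkorokhodSpace (t : ℝ) where
  /-- the path -/
  path : Set.Icc (0 : ℝ) t → K
  rightCont : ∀ s, Filter.Tendsto path (𝓝[>] s) (𝓝 (path s))
  leftLim : ∀ s, ∃ l, Filter.Tendsto path (𝓝[<] s) (𝓝 l)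
  leftContEnd : ∀ s : Set.Icc (0 : ℝ) t, (s : ℝ) = t →
    Filter.Tendsto path (𝓝[<] s) (𝓝 (path s))

variable {K}

/-- `g` is within `ε` of `f` in the Skorokhod sense: after a time change `τ` (an increasing
bijection of `[0,t]`) that moves no time by `ε` or more, the paths are uniformly `ε`-close. -/
def SkorokhodNear {t : ℝ} (ε : ℝ) (f g : SkorokhodSpace K t) : Prop :=
  ∃ τ : Set.Icc (0 : ℝ) t ≃o Set.Icc (0 : ℝ) t,
    (∀ s, |(τ s : ℝ) - (s : ℝ)| < ε) ∧ ∀ s, canonAbs (f.path s - g.path (τ s)) < ε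

/-- The Skorokhod topology on `D[0,t]`. -/
instance (t : ℝ) : TopologicalSpace (SkorokhodSpace K t) where
  IsOpen U := ∀ f ∈ U, ∃ ε > 0, ∀ g, SkorokhodNear ε f g → g ∈ U
  isOpen_univ := fun _ _ => ⟨1, one_pos, fun _ _ => trivial⟩
  isOpen_inter := by
    rintro U V hU hV f ⟨hfU, hfV⟩
    obtain ⟨ε, hε, h⟩ := hU f hfU
    obtain ⟨δ, hδ, h'⟩ := hV f hfV
    refine ⟨min ε δ, lt_min hε hδ, fun g ⟨τ, h1, h2⟩ => ⟨h g ⟨τ, ?_, ?_⟩, h' g ⟨τ, ?_, ?_⟩⟩⟩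
    · exact fun s => (h1 s).trans_le (min_le_left _ _)
    · exact fun s => (h2 s).trans_le (min_le_left _ _)
    · exact fun s => (h1 s).trans_le (min_le_right _ _)
    · exact fun s => (h2 s).trans_le (min_le_right _ _)
  isOpen_sUnion := by
    rintro C hC f ⟨U, hU, hfU⟩
    obtain ⟨ε, hε, h⟩ := hC U hU f hfU
    exact ⟨ε, hε, fun g hg => ⟨U, hU, h g hg⟩⟩

/-- `D[0,t]` carries the Borel sets of the Skorokhod topology. -/
instance (t : ℝ) : MeasurableSpace (SkorokhodSpace K t) := borel _

instance (t : ℝ) : BorelSpace (SkorokhodSpace K t) := ⟨rfl⟩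

/-- The number `∑ p_{t_1,n}(b_1 - a) p_{t_2-t_1,n}(b_2 - b_1) ⋯ p_{t_N-t_{N-1},n}(b_N - b_{N-1}) q^{-nN}`,
summed over all `b_i ∈ J_i ∩ X_n`. -/
def cylinderMass (β : 𝒪[K]) (S : Finset 𝒪[K]) (χ : AddChar K Circle) (α : ℝ) (n : ℕ) (a : K)
    {N : ℕ} (τ : Fin N → ℝ) (J : Fin N → Set K) : ℂ :=
  open Classical in
  ∑ b ∈ (Fintype.piFinset fun _ : Fin N => grid β S n) with ∀ i, b i ∈ J i,
    (∏ i : Fin N, density β S χ α n (τ i - (Fin.cons 0 τ : Fin (N + 1) → ℝ) i.castSucc)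
      (b i - (Fin.cons a b : Fin (N + 1) → K) i.castSucc)) * ((resCard K : ℂ) ^ (n * N))⁻¹

/-- `P` is the measure `P_a^n`: a probability measure on the Borel sets of `D[0,t]` with the
prescribed values on cylinder sets. -/
structure IsGridWalkMeasure (β : 𝒪[K]) (S : Finset 𝒪[K]) (χ : AddChar K Circle) (α : ℝ) (n : ℕ)
    (a : K) {t : ℝ} (P : MeasureTheory.Measure (SkorokhodSpace K t)) : Prop where
  isProb : MeasureTheory.IsProbabilityMeasure P
  cylinder : ∀ (N : ℕ) (τ : Fin N → Set.Icc (0 : ℝ) t), StrictMono τ →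
    ∀ J : Fin N → Set K, (∀ i, MeasurableSet[borel K] (J i)) →
      ((P.real {ω | ∀ i, ω.path (τ i) ∈ J i} : ℝ) : ℂ) =
        cylinderMass β S χ α n a (fun i => (τ i : ℝ)) J

end Field

end LocalFieldWalk

end

/-! Existence. The grid is a system of representatives of the finite group `B_n/B_{-n}`, which `χ`
makes self-dual because it has rank zero (`sum_grid_char`). On this group `-|y|^α` is a
Lévy–Khinchin exponent. Indeed `|·|^α` is a nonnegative combination of indicators of complements of
balls, and the Fourier transform of a ball is a nonnegative multiple of the indicator of the dual
ball. Hence minus the inverse transform of `|·|^α` is nonnegative away from `0` (`rate_nonneg`) and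
serves as a family of jump rates (`sum_jumpRate_mul`).

The required law is that of the compound Poisson process with these rates: a Poisson number `k` of
jumps, independent uniform jump times in `(0,t)`, and independent jump sizes. It is built directly
on `D[0,t]` as a weighted sum of images of Lebesgue measure on `(0,t)^k`. This needs the step path
to depend measurably on its jump times (`aemeasurable_jumpPath`) and evaluations to be Borel for the
Skorokhod topology (`measurableSet_path_near`). For the finite-dimensional laws, a cylinder event is
expanded in characters of its increments (`indicator_jumpPath`). Integration over times and
summation over sizes give a `k`-th power for each choice of frequencies (`jumpMeasure_cylinder`),
and the sum over `k` is an exponential series, which yields the product of the densities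
(`walkMeasure_cylinder`).

Full measure. For any measure with the prescribed cylinder values, the event of being off the grid
at a fixed time has mass given by an empty sum. Almost surely the path is thus on the grid at time
`t` and on a countable dense set of times; as the grid is closed, right-continuity covers the other
times. -/

noncomputable section

namespace LocalFieldWalk

/-! ### Balls as fractional ideals and neighbourhoods of zero -/

section Balls

variable {K : Type*} [Field K] [ValuativeRel K] [TopologicalSpace K]
  [IsNonarchimedeanLocalField K] {β : 𝒪[K]}

theorem IsUniformizer.coe_ne_zero (hβ : IsUniformizer β) : (β : K) ≠ 0 := by
  intro h0
  have h1 : β = 0 := Subtype.ext h0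
  have h2 : 𝓂[K] = ⊥ := by
    rw [IsUniformizer, h1] at hβ
    simpa using hβ
  exact IsDiscreteValuationRing.not_a_field 𝒪[K] h2

theorem mem_ball_iff (hβ : IsUniformizer β) {r : ℤ} {x : K} :
    x ∈ ball β r ↔ x * (β : K) ^ r ∈ 𝒪[K] := by
  have h := zpow_ne_zero r hβ.coe_ne_zero
  constructor
  · rintro ⟨y, rfl⟩
    rw [zpow_neg, mul_right_comm, inv_mul_cancel₀ h, one_mul]
    exact y.2
  · intro hx
    refine ⟨⟨_, hx⟩, ?_⟩
    rw [zpow_neg]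
    field_simp

/-- The ball `B_r` as an additive subgroup. -/
def ballSubgroup (hβ : IsUniformizer β) (r : ℤ) : AddSubgroup K where
  carrier := ball β r
  zero_mem' := by rw [mem_ball_iff hβ, zero_mul]; exact zero_mem _
  add_mem' {x y} hx hy := by
    rw [mem_ball_iff hβ] at *
    rw [add_mul]; exact add_mem hx hy
  neg_mem' {x} hx := by
    rw [mem_ball_iff hβ] at *
    rw [neg_mul]; exact neg_mem hx

theorem mem_ballSubgroup {hβ : IsUniformizer β} {r : ℤ} {x : K} :
    x ∈ ballSubgroup hβ r ↔ x ∈ ball β r := Iff.rfl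

theorem mul_mem_ball (hβ : IsUniformizer β) {r s : ℤ} {x y : K} (hx : x ∈ ball β r)
    (hy : y ∈ ball β s) : x * y ∈ ball β (r + s) := by
  rw [mem_ball_iff hβ] at *
  rw [zpow_add₀ hβ.coe_ne_zero, mul_mul_mul_comm]
  exact mul_mem hx hy

theorem ball_mono (hβ : IsUniformizer β) {r s : ℤ} (h : r ≤ s) : ball β r ⊆ ball β s := by
  intro x hx
  rw [mem_ball_iff hβ] at *
  obtain ⟨k, rfl⟩ := Int.le.dest h
  rw [zpow_add₀ hβ.coe_ne_zero, ← mul_assoc, zpow_natCast]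
  exact mul_mem hx (pow_mem β.2 k)

/-- If `yβ^r` is not integral, its inverse has valuation less than `1`, so it lies in `P = βO`; the
extra factor `β` accounts for the `-1` in the radius. -/
theorem inv_mem_ball (hβ : IsUniformizer β) {r : ℤ} {y : K} (hy : y ∉ ball β r) :
    y⁻¹ ∈ ball β (-r - 1) := by
  rw [mem_ball_iff hβ, Valuation.mem_integer_iff, not_le] at hy
  set w := y * (β : K) ^ r with hw
  have hw0 : w ≠ 0 := by rintro h; simp [h] at hy
  have hy0 : y ≠ 0 := by rintro rfl; simp [hw] at hw0
  have hlt : ValuativeRel.valuation K w⁻¹ < 1 := by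
    rw [map_inv₀]; exact inv_lt_one_of_one_lt₀ hy
  have hmem : (⟨w⁻¹, hlt.le⟩ : 𝒪[K]) ∈ 𝓂[K] := by
    rw [IsLocalRing.mem_maximalIdeal, mem_nonunits_iff]
    rintro hu
    obtain ⟨z, hz⟩ := hu.exists_right_inv
    have h1 : w⁻¹ * (z : K) = 1 := congrArg Subtype.val hz
    have h2 : (z : K) = w := by field_simp at h1; exact h1
    have := z.2
    rw [h2, Valuation.mem_integer_iff] at this
    exact absurd hy (not_lt.2 this)
  rw [hβ, Ideal.mem_span_singleton] at hmem
  obtain ⟨o, ho⟩ := hmem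
  have h1 : w⁻¹ = β * (o : K) := congrArg Subtype.val ho
  refine ⟨o, ?_⟩
  have hb := hβ.coe_ne_zero
  have hbr := zpow_ne_zero r hb
  rw [neg_sub, sub_neg_eq_add, zpow_add₀ hb, zpow_one, mul_right_comm, ← h1, hw, mul_inv]
  field_simp

theorem ball_mem_nhds (hβ : IsUniformizer β) (r : ℤ) : ball β r ∈ 𝓝 (0 : K) := by
  have h : (ValuativeRel.valuation K ((β : K) ^ (-r))) ≠ 0 :=
    (map_ne_zero _).2 (zpow_ne_zero _ hβ.coe_ne_zero)
  refine Filter.mem_of_superset ((IsValuativeTopology.hasBasis_nhds_zero' K).mem_of_mem h) ?_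
  intro x hx
  rw [mem_ball_iff hβ, Valuation.mem_integer_iff, map_mul]
  have h2 : ValuativeRel.valuation K ((β : K) ^ r) ≠ 0 :=
    (map_ne_zero _).2 (zpow_ne_zero _ hβ.coe_ne_zero)
  rw [Set.mem_ofPred_eq, zpow_neg, map_inv₀] at hx
  calc _ ≤ (ValuativeRel.valuation K ((β : K) ^ r))⁻¹ * ValuativeRel.valuation K ((β : K) ^ r) := by
        gcongr
    _ = 1 := inv_mul_cancel₀ h2

end Balls

/-! ### The canonical absolute value and its ultrametric inequality -/

section CanonAbs

variable {K : Type*} [Field K] [ValuativeRel K] [TopologicalSpace K]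
  [IsNonarchimedeanLocalField K] {β : 𝒪[K]}

theorem canonAbs_zero : canonAbs (0 : K) = 0 := by simp [canonAbs]

theorem canonAbs_of_ne {x : K} (hx : x ≠ 0) :
    canonAbs x = (MeasureTheory.distribHaarChar K (Units.mk0 x hx) : ℝ) := by
  simp [canonAbs, hx]

theorem canonAbs_pos {x : K} (hx : x ≠ 0) : 0 < canonAbs x := by
  rw [canonAbs_of_ne hx]
  exact_mod_cast MeasureTheory.distribHaarChar_pos

theorem canonAbs_nonneg (x : K) : 0 ≤ canonAbs x := by
  by_cases hx : x = 0
  · rw [hx, canonAbs_zero]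
  · exact (canonAbs_pos hx).le

theorem canonAbs_mul (x y : K) : canonAbs (x * y) = canonAbs x * canonAbs y := by
  by_cases hx : x = 0
  · simp [hx, canonAbs_zero]
  by_cases hy : y = 0
  · simp [hy, canonAbs_zero]
  rw [canonAbs_of_ne hx, canonAbs_of_ne hy, canonAbs_of_ne (mul_ne_zero hx hy),
    Units.mk0_mul, map_mul]
  simp

theorem canonAbs_one : canonAbs (1 : K) = 1 := by
  have h := canonAbs_mul (1 : K) 1
  rw [mul_one] at h
  exact (mul_eq_left₀ (canonAbs_pos one_ne_zero).ne').1 h.symm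

open scoped Pointwise in
/-- `|x|` is the ratio of the Haar measures of `xO` and `O`. -/
theorem canonAbs_mul_measure [MeasurableSpace K] [BorelSpace K] (x : K) (hx : x ≠ 0) :
    ENNReal.ofReal (canonAbs x) * (MeasureTheory.Measure.addHaar (𝒪[K] : Set K)) =
      MeasureTheory.Measure.addHaar (x • (𝒪[K] : Set K)) := by
  rw [canonAbs_of_ne hx, ENNReal.ofReal_coe_nnreal,
    MeasureTheory.distribHaarChar_mul MeasureTheory.Measure.addHaar]
  rfl

theorem integer_measure_ne_zero [MeasurableSpace K] [BorelSpace K] (hβ : IsUniformizer β) :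
    MeasureTheory.Measure.addHaar (𝒪[K] : Set K) ≠ 0 := by
  have h : (𝒪[K] : Set K) ∈ 𝓝 (0 : K) := by
    refine Filter.mem_of_superset (ball_mem_nhds hβ 0) ?_
    rintro x ⟨y, rfl⟩
    simp
  exact (MeasureTheory.Measure.measure_pos_of_mem_nhds _ h).ne'

theorem integer_measure_ne_top [MeasurableSpace K] [BorelSpace K] :
    MeasureTheory.Measure.addHaar (𝒪[K] : Set K) ≠ ⊤ :=
  (IsNonarchimedeanLocalField.isCompact_closedBall K 1).measure_ne_top

open scoped Pointwise in
theorem canonAbs_le_one (hβ : IsUniformizer β) {x : K} (hx : x ∈ 𝒪[K]) : canonAbs x ≤ 1 := by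
  borelize K
  by_cases h0 : x = 0
  · rw [h0, canonAbs_zero]; exact zero_le_one
  have h := canonAbs_mul_measure x h0
  have h1 : x • (𝒪[K] : Set K) ⊆ 𝒪[K] := by
    rintro _ ⟨y, hy, rfl⟩
    exact mul_mem hx hy
  have h2 := MeasureTheory.measure_mono (μ := MeasureTheory.Measure.addHaar) h1
  rw [← h] at h2
  by_contra hlt
  push Not at hlt
  have h3 : 1 < ENNReal.ofReal (canonAbs x) := by
    rw [← ENNReal.ofReal_one]; exact (ENNReal.ofReal_lt_ofReal_iff (by linarith)).2 hlt
  have := ENNReal.mul_lt_mul_left (integer_measure_ne_zero hβ) integer_measure_ne_top h3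
  rw [one_mul] at this
  exact absurd h2 (not_le.2 this)

/-- By multiplicativity this is the bound on integers applied to `x / y`. It transfers the
ultrametric inequality from the valuation to the Haar scaling factor. -/
theorem canonAbs_le_of_valuation_le (hβ : IsUniformizer β) {x y : K}
    (h : ValuativeRel.valuation K x ≤ ValuativeRel.valuation K y) : canonAbs x ≤ canonAbs y := by
  by_cases hy : y = 0
  · rw [hy, map_zero, le_zero_iff, map_eq_zero] at h
    rw [h, hy]
  have h1 : x / y ∈ 𝒪[K] := by
    rw [Valuation.mem_integer_iff, map_div₀]
    exact div_le_one_of_le₀ h zero_le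
  have h2 := canonAbs_le_one hβ h1
  calc canonAbs x = canonAbs (x / y) * canonAbs y := by rw [← canonAbs_mul, div_mul_cancel₀ _ hy]
    _ ≤ 1 * canonAbs y := by gcongr; exact canonAbs_nonneg y
    _ = _ := one_mul _

theorem canonAbs_neg (hβ : IsUniformizer β) (x : K) : canonAbs (-x) = canonAbs x :=
  le_antisymm (canonAbs_le_of_valuation_le hβ (Valuation.map_neg _ _).le)
    (canonAbs_le_of_valuation_le hβ (Valuation.map_neg _ _).ge)

theorem canonAbs_sub_comm (hβ : IsUniformizer β) (x y : K) :
    canonAbs (x - y) = canonAbs (y - x) := by rw [← canonAbs_neg hβ, neg_sub]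

theorem canonAbs_add_lt (hβ : IsUniformizer β) {x y : K} {r : ℝ} (hx : canonAbs x < r)
    (hy : canonAbs y < r) : canonAbs (x + y) < r := by
  rcases le_total (ValuativeRel.valuation K x) (ValuativeRel.valuation K y) with h | h
  · refine (canonAbs_le_of_valuation_le hβ ?_).trans_lt hy
    exact (Valuation.map_add _ _ _).trans (max_le h le_rfl)
  · refine (canonAbs_le_of_valuation_le hβ ?_).trans_lt hx
    exact (Valuation.map_add _ _ _).trans (max_le le_rfl h)

open scoped Pointwise in
-- The cosets `βO` and `1 + βO` are disjoint subsets of `O`, each of measure `|β| μ(O)`, so `2|β| ≤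
-- 1`. The exact value `1/q` is not needed.
theorem canonAbs_uniformizer_lt_one (hβ : IsUniformizer β) : canonAbs (β : K) < 1 := by
  borelize K
  set μ : MeasureTheory.Measure K := MeasureTheory.Measure.addHaar with hμ
  have h := canonAbs_mul_measure (β : K) hβ.coe_ne_zero
  rw [← hμ] at h
  set A : Set K := (β : K) • (𝒪[K] : Set K) with hA
  have hAO : ∀ x ∈ A, ∃ y : 𝒪[K], x = β * (y : K) := by
    rintro _ ⟨y, hy, rfl⟩
    exact ⟨⟨y, hy⟩, rfl⟩
  have hcomp : IsCompact (𝒪[K] : Set K) := IsNonarchimedeanLocalField.isCompact_closedBall K 1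
  have hopen : IsOpen A := by
    have : A = ((ballSubgroup hβ (-1) : AddSubgroup K) : Set K) := by
      ext x
      constructor
      · intro hx
        obtain ⟨y, rfl⟩ := hAO x hx
        exact ⟨y, by simp⟩
      · rintro ⟨y, rfl⟩
        exact ⟨y, y.2, by simp⟩
    rw [this]
    exact AddSubgroup.isOpen_of_mem_nhds _ (g := 0) (ball_mem_nhds hβ (-1))
  have hmeas : MeasurableSet A := hopen.measurableSet
  have hdisj : Disjoint A ((1 : K) +ᵥ A) := by
    rw [Set.disjoint_left]
    rintro x hx ⟨y, hy, hxy⟩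
    obtain ⟨x', rfl⟩ := hAO x hx
    obtain ⟨y', rfl⟩ := hAO y hy
    have h1 : β * (x' - y') = 1 := by
      apply Subtype.ext
      push_cast
      have : (1 : K) + β * (y' : K) = β * x' := hxy
      linear_combination -this
    have h2 : (1 : 𝒪[K]) ∈ 𝓂[K] := by
      rw [hβ, Ideal.mem_span_singleton, ← h1]
      exact dvd_mul_right _ _
    exact (IsLocalRing.maximalIdeal.isMaximal 𝒪[K]).ne_top ((Ideal.eq_top_iff_one _).2 h2)
  have hsub : A ∪ ((1 : K) +ᵥ A) ⊆ 𝒪[K] := by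
    rintro x (hx | ⟨y, hy, rfl⟩)
    · obtain ⟨x', rfl⟩ := hAO x hx
      exact mul_mem β.2 x'.2
    · obtain ⟨y', rfl⟩ := hAO y hy
      exact add_mem (one_mem _) (mul_mem β.2 y'.2)
  have h2 := MeasureTheory.measure_mono (μ := μ) hsub
  rw [MeasureTheory.measure_union hdisj (hmeas.const_vadd _), MeasureTheory.measure_vadd, ← h] at h2
  by_contra hlt
  push Not at hlt
  have hO0 := integer_measure_ne_zero hβ
  have hOt := integer_measure_ne_top (K := K)
  rw [← hμ] at hO0 hOt
  have h3 : 1 ≤ ENNReal.ofReal (canonAbs (β : K)) := by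
    rw [← ENNReal.ofReal_one]; exact ENNReal.ofReal_le_ofReal hlt
  have h4 : μ (𝒪[K] : Set K) + μ (𝒪[K] : Set K) ≤ μ (𝒪[K] : Set K) := by
    refine le_trans ?_ h2
    gcongr <;> exact le_mul_of_one_le_left zero_le h3
  exact absurd h4 (not_le.2 (ENNReal.lt_add_right hOt hO0))

theorem canonAbs_zpow (x : K) (r : ℤ) : canonAbs (x ^ r) = canonAbs x ^ r := by
  let f : K →*₀ ℝ :=
    { toFun := canonAbs, map_zero' := canonAbs_zero, map_one' := canonAbs_one,
      map_mul' := canonAbs_mul }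
  exact map_zpow₀ f x r

theorem canonAbs_le_of_mem_ball (hβ : IsUniformizer β) {r : ℤ} {x : K} (hx : x ∈ ball β r) :
    canonAbs x ≤ canonAbs (β : K) ^ (-r) := by
  obtain ⟨y, rfl⟩ := hx
  rw [canonAbs_mul, canonAbs_zpow]
  exact mul_le_of_le_one_right (zpow_nonneg (canonAbs_nonneg _) _) (canonAbs_le_one hβ y.2)

/-- The lower bound is the upper bound for `x⁻¹`, which lies in `B_{-r}` by `inv_mem_ball`. -/
theorem canonAbs_eq_of_mem_sphere (hβ : IsUniformizer β) {r : ℤ} {x : K} (hx : x ∈ ball β r)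
    (hx' : x ∉ ball β (r - 1)) : canonAbs x = canonAbs (β : K) ^ (-r) := by
  refine le_antisymm (canonAbs_le_of_mem_ball hβ hx) ?_
  have hb := canonAbs_pos hβ.coe_ne_zero
  have hx0 : x ≠ 0 := by rintro rfl; exact hx' (zero_mem (ballSubgroup hβ (r - 1)))
  have h := canonAbs_le_of_mem_ball hβ (inv_mem_ball hβ hx')
  have h1 : canonAbs x * canonAbs x⁻¹ = 1 := by
    rw [← canonAbs_mul, mul_inv_cancel₀ hx0, canonAbs_one]
  have h2 : -(-(r - 1) - 1) = r := by ring
  rw [h2] at h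
  have hbr := zpow_pos hb r
  have hpos := canonAbs_pos hx0
  rw [zpow_neg]
  rw [inv_le_iff_one_le_mul₀ hbr, ← h1]
  gcongr

theorem canonAbs_lt_mem_nhds (hβ : IsUniformizer β) {ρ : ℝ} (hρ : 0 < ρ) (b : K) :
    {x : K | canonAbs (x - b) < ρ} ∈ 𝓝 b := by
  obtain ⟨k, hk⟩ := exists_pow_lt_of_lt_one hρ (canonAbs_uniformizer_lt_one hβ)
  have h := ball_mem_nhds hβ (-(k : ℤ))
  have hc : Filter.Tendsto (fun x : K => x - b) (𝓝 b) (𝓝 0) := by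
    have : Continuous fun x : K => x - b := by fun_prop
    simpa using this.tendsto b
  filter_upwards [hc h] with x hx
  refine (canonAbs_le_of_mem_ball hβ hx).trans_lt ?_
  simpa using hk

end CanonAbs

/-! ### The grid as a system of representatives for `B_n/B_{-n}` -/

section Grid

theorem mem_grid {K : Type*} [Field K] [ValuativeRel K] {β : 𝒪[K]} {S : Finset 𝒪[K]} {n : ℕ} {x : K} :
    x ∈ grid β S n ↔ ∃ c : Fin (2 * n) → 𝒪[K], (∀ j, c j ∈ S) ∧
    ∑ j : Fin (2 * n), (c j : K) * (β : K) ^ ((j : ℤ) - (n : ℤ)) = x := by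
  simp [grid]

variable {K : Type*} [Field K] [ValuativeRel K] [TopologicalSpace K]
  [IsNonarchimedeanLocalField K] {β : 𝒪[K]} {S : Finset 𝒪[K]}

theorem IsRepSystem.card_eq (hS : IsRepSystem S) : S.card = resCard K := by
  have h := hS.ncard_eq
  rwa [Set.ncard_coe_finset, Set.ncard_univ] at h

theorem residue_eq_iff_dvd (hβ : IsUniformizer β) (x y : 𝒪[K]) :
    IsLocalRing.residue 𝒪[K] x = IsLocalRing.residue 𝒪[K] y ↔ β ∣ x - y := by
  rw [← sub_eq_zero, ← map_sub, IsLocalRing.residue_eq_zero_iff, hβ, Ideal.mem_span_singleton]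

theorem exists_digits (hβ : IsUniformizer β) (hS : IsRepSystem S) (m : ℕ) (x : 𝒪[K]) :
    ∃ c : Fin m → 𝒪[K], (∀ j, c j ∈ S) ∧ β ^ m ∣ x - ∑ j, c j * β ^ (j : ℕ) := by
  induction m generalizing x with
  | zero => exact ⟨Fin.elim0, fun j => j.elim0, by simp⟩
  | succ m ih =>
    obtain ⟨c₀, hc₀, hx⟩ := hS.surjOn (Set.mem_univ (IsLocalRing.residue 𝒪[K] x))
    obtain ⟨x', hx'⟩ := (residue_eq_iff_dvd hβ x c₀).1 hx.symm
    obtain ⟨c, hc, y, hy⟩ := ih x'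
    refine ⟨Fin.cons c₀ c, ?_, y, ?_⟩
    · intro j
      refine Fin.cases ?_ (fun i => ?_) j
      · simpa using hc₀
      · simpa using hc i
    · rw [Fin.sum_univ_succ]
      simp only [Fin.cons_zero, Fin.cons_succ, Fin.val_zero, Fin.val_succ, pow_zero, mul_one]
      have : ∑ i : Fin m, c i * β ^ ((i : ℕ) + 1) = β * ∑ i : Fin m, c i * β ^ (i : ℕ) := by
        rw [Finset.mul_sum]
        exact Finset.sum_congr rfl fun i _ => by ring
      rw [this]
      linear_combination hx' + β * hy

theorem digits_unique (hβ : IsUniformizer β) (hS : IsRepSystem S) (m : ℕ) (c d : Fin m → 𝒪[K])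
    (hc : ∀ j, c j ∈ S) (hd : ∀ j, d j ∈ S)
    (h : β ^ m ∣ ∑ j, c j * β ^ (j : ℕ) - ∑ j, d j * β ^ (j : ℕ)) : c = d := by
  induction m with
  | zero => exact Subsingleton.elim _ _
  | succ m ih =>
    have hβ0 : β ≠ 0 := fun h => hβ.coe_ne_zero (by rw [h]; rfl)
    have key : ∀ e : Fin (m + 1) → 𝒪[K], ∑ j, e j * β ^ (j : ℕ) =
        e 0 + β * ∑ i : Fin m, e i.succ * β ^ (i : ℕ) := by
      intro e
      rw [Fin.sum_univ_succ, Finset.mul_sum]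
      simp only [Fin.val_zero, Fin.val_succ, pow_zero, mul_one]
      congr 1
      exact Finset.sum_congr rfl fun i _ => by ring
    rw [key, key] at h
    obtain ⟨y, hy⟩ := h
    have h0 : c 0 = d 0 := by
      refine hS.injOn (hc 0) (hd 0) ((residue_eq_iff_dvd hβ _ _).2 ⟨β ^ m * y -
        (∑ i : Fin m, c i.succ * β ^ (i : ℕ) - ∑ i : Fin m, d i.succ * β ^ (i : ℕ)), ?_⟩)
      linear_combination hy
    have h1 := ih (fun i => c i.succ) (fun i => d i.succ) (fun i => hc _) (fun i => hd _) ⟨y, by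
      apply mul_left_cancel₀ hβ0
      linear_combination hy - h0⟩
    funext j
    refine Fin.cases h0 (fun i => congrFun h1 i) j

/-- Rescaling by `β^n` turns `B_n/B_{-n}` into `O/β^{2n}O`, so that grid points become ordinary
digit expansions of length `2n`. -/
theorem sum_digits_eq (hβ : IsUniformizer β) (n : ℕ) (c : Fin (2 * n) → 𝒪[K]) :
    ∑ j : Fin (2 * n), (c j : K) * (β : K) ^ ((j : ℤ) - (n : ℤ)) =
      (β : K) ^ (-(n : ℤ)) * ((∑ j, c j * β ^ (j : ℕ) : 𝒪[K]) : K) := by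
  push_cast
  rw [Finset.mul_sum]
  refine Finset.sum_congr rfl fun j _ => ?_
  rw [sub_eq_add_neg, zpow_add₀ hβ.coe_ne_zero, zpow_natCast]
  ring

theorem sub_mem_ball_neg_iff (hβ : IsUniformizer β) (n : ℕ) (x y : 𝒪[K]) :
    (β : K) ^ (-(n : ℤ)) * (x : K) - (β : K) ^ (-(n : ℤ)) * (y : K) ∈ ball β (-(n : ℤ)) ↔
      β ^ (2 * n) ∣ x - y := by
  have hb := hβ.coe_ne_zero
  have hn : ((β : K) ^ n) ≠ 0 := pow_ne_zero _ hb
  constructor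
  · rintro ⟨z, hz⟩
    refine ⟨z, Subtype.ext ?_⟩
    push_cast
    rw [neg_neg, zpow_neg, zpow_natCast, ← mul_sub] at hz
    field_simp at hz
    rw [hz]; ring
  · rintro ⟨z, hz⟩
    refine ⟨z, ?_⟩
    have hz' : (x : K) - y = β ^ (2 * n) * z := by
      have := congrArg Subtype.val hz
      push_cast at this
      exact this
    rw [neg_neg, zpow_neg, zpow_natCast, ← mul_sub, hz', two_mul, pow_add]
    field_simp

theorem grid_subset_ball (hβ : IsUniformizer β) {n : ℕ} {x : K} (hx : x ∈ grid β S n) :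
    x ∈ ball β (n : ℤ) := by
  obtain ⟨c, -, rfl⟩ := mem_grid.1 hx
  exact ⟨_, sum_digits_eq hβ n c⟩

theorem exists_mem_grid_sub_mem (hβ : IsUniformizer β) (hS : IsRepSystem S) {n : ℕ} {x : K}
    (hx : x ∈ ball β (n : ℤ)) : ∃ y ∈ grid β S n, x - y ∈ ball β (-(n : ℤ)) := by
  obtain ⟨o, rfl⟩ := hx
  obtain ⟨c, hc, hd⟩ := exists_digits hβ hS (2 * n) o
  refine ⟨_, mem_grid.2 ⟨c, hc, rfl⟩, ?_⟩
  rw [sum_digits_eq hβ, sub_mem_ball_neg_iff hβ]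
  exact hd

theorem eq_of_sub_mem (hβ : IsUniformizer β) (hS : IsRepSystem S) {n : ℕ} {x y : K}
    (hx : x ∈ grid β S n) (hy : y ∈ grid β S n) (h : x - y ∈ ball β (-(n : ℤ))) : x = y := by
  obtain ⟨c, hc, rfl⟩ := mem_grid.1 hx
  obtain ⟨d, hd, rfl⟩ := mem_grid.1 hy
  rw [sum_digits_eq hβ, sum_digits_eq hβ, sub_mem_ball_neg_iff hβ] at h
  rw [digits_unique hβ hS _ c d hc hd h]

theorem card_grid (hβ : IsUniformizer β) (hS : IsRepSystem S) (n : ℕ) :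
    (grid β S n).card = resCard K ^ (2 * n) := by
  classical
  rw [grid, Finset.card_image_of_injOn, Fintype.card_piFinset, Finset.prod_const, hS.card_eq,
    Finset.card_univ, Fintype.card_fin]
  intro c hc d hd h
  rw [Finset.mem_coe, Fintype.mem_piFinset] at hc hd
  refine digits_unique hβ hS _ c d hc hd ((sub_mem_ball_neg_iff hβ n _ _).1 ?_)
  rw [← sum_digits_eq hβ, ← sum_digits_eq hβ]
  simp only at h
  rw [h, sub_self]
  exact zero_mem (ballSubgroup hβ _)

theorem resCard_pos : 0 < resCard K := Nat.card_pos

/-- The representative in the grid of a point of `B_n` modulo `B_{-n}` (and `0` off `B_n`). -/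
def gridRep (β : 𝒪[K]) (S : Finset 𝒪[K]) (n : ℕ) (x : K) : K :=
  open Classical in
  if h : ∃ y ∈ grid β S n, x - y ∈ ball β (-(n : ℤ)) then h.choose else 0

theorem gridRep_spec (hβ : IsUniformizer β) (hS : IsRepSystem S) {n : ℕ} {x : K}
    (hx : x ∈ ball β (n : ℤ)) :
    gridRep β S n x ∈ grid β S n ∧ x - gridRep β S n x ∈ ball β (-(n : ℤ)) := by
  have h := exists_mem_grid_sub_mem hβ hS hx
  rw [gridRep, dif_pos h]
  exact h.choose_spec

theorem gridRep_eq_iff (hβ : IsUniformizer β) (hS : IsRepSystem S) {n : ℕ} {x b : K}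
    (hx : x ∈ ball β (n : ℤ)) (hb : b ∈ grid β S n) :
    gridRep β S n x = b ↔ x - b ∈ ball β (-(n : ℤ)) := by
  obtain ⟨h1, h2⟩ := gridRep_spec hβ hS hx
  constructor
  · rintro rfl; exact h2
  · intro h
    refine eq_of_sub_mem hβ hS h1 hb ?_
    have := (ballSubgroup hβ (-(n : ℤ))).sub_mem h h2
    rwa [sub_sub_sub_cancel_left] at this

/-- Translation by `c` permutes the cosets of `B_{-n}` in `B_n`; a sum of an invariant function over
representatives does not see the difference. -/
theorem sum_grid_add (hβ : IsUniformizer β) (hS : IsRepSystem S) {n : ℕ} (f : K → ℂ)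
    (hf : ∀ x, ∀ h ∈ ball β (-(n : ℤ)), f (x + h) = f x) {c : K} (hc : c ∈ ball β (n : ℤ)) :
    ∑ x ∈ grid β S n, f (x + c) = ∑ x ∈ grid β S n, f x := by
  have hadd : ∀ x ∈ grid β S n, x + c ∈ ball β (n : ℤ) := fun x hx =>
    (ballSubgroup hβ (n : ℤ)).add_mem (grid_subset_ball hβ hx) hc
  have hsub : ∀ x ∈ grid β S n, x - c ∈ ball β (n : ℤ) := fun x hx =>
    (ballSubgroup hβ (n : ℤ)).sub_mem (grid_subset_ball hβ hx) hc
  refine Finset.sum_nbij' (fun x => gridRep β S n (x + c)) (fun x => gridRep β S n (x - c))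
    (fun x hx => (gridRep_spec hβ hS (hadd x hx)).1)
    (fun x hx => (gridRep_spec hβ hS (hsub x hx)).1) ?_ ?_ ?_
  · intro x hx
    have h1 := gridRep_spec hβ hS (hadd x hx)
    rw [gridRep_eq_iff hβ hS (hsub _ h1.1) hx]
    have := (ballSubgroup hβ (-(n : ℤ))).neg_mem h1.2
    rw [mem_ballSubgroup] at this
    convert this using 1; ring
  · intro x hx
    have h1 := gridRep_spec hβ hS (hsub x hx)
    rw [gridRep_eq_iff hβ hS (hadd _ h1.1) hx]
    have := (ballSubgroup hβ (-(n : ℤ))).neg_mem h1.2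
    rw [mem_ballSubgroup] at this
    convert this using 1; ring
  · intro x hx
    have h1 := gridRep_spec hβ hS (hadd x hx)
    rw [← hf (gridRep β S n (x + c)) _ h1.2]
    congr 1; ring

end Grid

/-! ### Finite Fourier analysis and the jump rates -/

section Fourier

variable {K : Type*} [Field K] [ValuativeRel K] [TopologicalSpace K]
  [IsNonarchimedeanLocalField K] {β : 𝒪[K]} {S : Finset 𝒪[K]} {χ : AddChar K Circle}

theorem char_mul_eq_one (hβ : IsUniformizer β) (hχ : IsRankZeroChar β χ) {r : ℤ} {x y : K}
    (hx : x ∈ ball β r) (hy : y ∈ ball β (-r)) : χ (x * y) = 1 := by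
  refine hχ.2.1 _ ?_
  have := mul_mem_ball hβ hx hy
  rwa [add_neg_cancel] at this

/-- Maximality of the rank makes `χ` nontrivial on `B_1`; dividing a witness there by `y` brings it
into `B_r`. -/
theorem exists_char_mul_ne_one (hβ : IsUniformizer β) (hχ : IsRankZeroChar β χ) {r : ℤ} {y : K}
    (hy : y ∉ ball β (-r)) : ∃ x ∈ ball β r, χ (x * y) ≠ 1 := by
  have h1 : ¬ ∀ x ∈ ball β 1, χ x = 1 := fun h => by
    have := hχ.2.2 h
    omega
  push Not at h1
  obtain ⟨x, hx, hx1⟩ := h1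
  have hy0 : y ≠ 0 := by rintro rfl; exact hy (zero_mem (ballSubgroup hβ _))
  refine ⟨x * y⁻¹, ?_, ?_⟩
  · have := mul_mem_ball hβ hx (inv_mem_ball hβ hy)
    convert this using 2; ring
  · rwa [inv_mul_cancel_right₀ hy0]

/-- Sum of a character over the part of the grid in a ball. -/
theorem sum_grid_char_mul (hβ : IsUniformizer β) (hS : IsRepSystem S) (hχ : IsRankZeroChar β χ)
    {n : ℕ} {r : ℤ} (hr : -(n : ℤ) ≤ r) (hr' : r ≤ n) {z : K} (hz : z ∈ ball β (n : ℤ)) :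
    open Classical in
    ∑ y ∈ grid β S n, (if y ∈ ball β r then (χ (z * y) : ℂ) else 0) =
      if z ∈ ball β (-r) then (((grid β S n).filter (· ∈ ball β r)).card : ℂ) else 0 := by
  classical
  split_ifs with h
  · rw [← Finset.sum_filter, Finset.cast_card]
    refine Finset.sum_congr rfl fun y hy => ?_
    rw [mul_comm, char_mul_eq_one hβ hχ (Finset.mem_filter.1 hy).2 h]
    rfl
  · obtain ⟨x, hx, hx1⟩ := exists_char_mul_ne_one hβ hχ h
    have hmem : ∀ y c, c ∈ ball β r → (y + c ∈ ball β r ↔ y ∈ ball β r) := fun y c hc =>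
      (ballSubgroup hβ r).add_mem_cancel_right hc
    -- Translation by `x` leaves the sum unchanged but also multiplies it by `χ(zx) ≠ 1`, so the sum
    -- vanishes.
    have key := sum_grid_add hβ hS (n := n) (fun y => if y ∈ ball β r then (χ (z * y) : ℂ) else 0)
      (fun y c hc => by
        simp only [hmem y c (ball_mono hβ hr hc), mul_add, AddChar.map_add_eq_mul,
          char_mul_eq_one hβ hχ hz hc, mul_one]) (ball_mono hβ hr' hx)
    simp only [hmem _ x hx, mul_add, AddChar.map_add_eq_mul] at key
    set T := ∑ y ∈ grid β S n, (if y ∈ ball β r then (χ (z * y) : ℂ) else 0) with hT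
    have h2 : (χ (z * x) : ℂ) * T = T := by
      conv_rhs => rw [← key]
      rw [hT, Finset.mul_sum]
      refine Finset.sum_congr rfl fun y _ => ?_
      split_ifs
      · rw [Circle.coe_mul, mul_comm]
      · rw [mul_zero]
    have h3 : (χ (z * x) : ℂ) ≠ 1 := by
      rw [mul_comm]
      intro h4
      exact hx1 (Circle.ext h4)
    by_contra hT0
    exact h3 (mul_right_cancel₀ hT0 (h2.trans (one_mul T).symm))

theorem sum_grid_char (hβ : IsUniformizer β) (hS : IsRepSystem S) (hχ : IsRankZeroChar β χ)
    {n : ℕ} {z : K} (hz : z ∈ ball β (n : ℤ)) :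
    open Classical in
    ∑ y ∈ grid β S n, (χ (z * y) : ℂ) =
      if z ∈ ball β (-(n : ℤ)) then (resCard K : ℂ) ^ (2 * n) else 0 := by
  classical
  have h := sum_grid_char_mul hβ hS hχ (n := n) (r := n) (by omega) le_rfl hz
  have h1 : ∀ y ∈ grid β S n, (if y ∈ ball β (n : ℤ) then (χ (z * y) : ℂ) else 0) = χ (z * y) :=
    fun y hy => if_pos (grid_subset_ball hβ hy)
  rw [Finset.sum_congr rfl h1,
    Finset.filter_true_of_mem fun y hy => grid_subset_ball hβ hy, card_grid hβ hS] at h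
  rw [h]
  push_cast
  rfl

/-- The jump rate of the walk: minus the inverse Fourier transform of `|·|^α`. -/
def rate (β : 𝒪[K]) (S : Finset 𝒪[K]) (χ : AddChar K Circle) (α : ℝ) (n : ℕ) (z : K) : ℂ :=
  -((resCard K : ℂ) ^ (2 * n))⁻¹ * ∑ y ∈ grid β S n, ((canonAbs y ^ α : ℝ) : ℂ) * χ (z * y)

open scoped ComplexOrder in
-- Layer-cake decomposition: `|·|^α` increases from ball to ball, so it is a nonnegative combination
-- of functions `1 - 1_B`. At `z ≠ 0` the transform of `1` vanishes and that of `1_B` is a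
-- cardinality or zero; the minus sign in `rate` cancels the one before `1_B`.
theorem rate_nonneg (hβ : IsUniformizer β) (hS : IsRepSystem S) (hχ : IsRankZeroChar β χ)
    {α : ℝ} (hα : 0 < α) {n : ℕ} (h0 : (0 : K) ∈ grid β S n) {z : K} (hz : z ∈ grid β S n)
    (hz0 : z ≠ 0) : 0 ≤ rate β S χ α n z := by
  classical
  have hzn : z ∉ ball β (-(n : ℤ)) := fun h => hz0 (eq_of_sub_mem hβ hS hz h0 (by rwa [sub_zero]))
  have hzB := grid_subset_ball hβ hz
  set b := canonAbs (β : K) with hb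
  have hb0 : 0 < b := canonAbs_pos hβ.coe_ne_zero
  have hb1 : b < 1 := canonAbs_uniformizer_lt_one hβ
  -- the values of `|·|^α` on spheres, in increasing order
  set w : ℕ → ℝ := fun k => if k = 0 then 0 else (b ^ (-((k : ℤ) - n))) ^ α with hw
  have hwmono : ∀ k, 0 ≤ w (k + 1) - w k := by
    intro k
    rw [sub_nonneg]
    simp only [hw, Nat.succ_ne_zero, if_false]
    split_ifs
    · positivity
    · refine Real.rpow_le_rpow (by positivity) ?_ hα.le
      exact zpow_le_zpow_right_of_le_one₀ hb0 hb1.le (by push_cast; omega)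
  have hlayer : ∀ y ∈ grid β S n, canonAbs y ^ α =
      ∑ k ∈ Finset.range (2 * n), (w (k + 1) - w k) *
        (if y ∈ ball β ((k : ℤ) - n) then 0 else 1) := by
    intro y hy
    have hyB : y ∈ ball β (((2 * n : ℕ) : ℤ) - n) := by
      have := grid_subset_ball hβ hy
      convert this using 2; push_cast; ring
    have hex : ∃ k : ℕ, y ∈ ball β ((k : ℤ) - n) := ⟨_, hyB⟩
    -- `m` indexes the smallest ball of the chain from `B_{-n}` to `B_n` that contains `y`.
    set m := Nat.find hex with hm
    have hm1 : y ∈ ball β ((m : ℤ) - n) := Nat.find_spec hex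
    have hm2 : m ≤ 2 * n := Nat.find_min' hex hyB
    have hmem : ∀ k : ℕ, y ∈ ball β ((k : ℤ) - n) ↔ ¬ k < m := by
      intro k
      constructor
      · intro h; exact not_lt.2 (Nat.find_min' hex h)
      · intro h; exact ball_mono hβ (by omega) hm1
    have hlhs : canonAbs y ^ α = w m := by
      -- The innermost ball `B_{-n}` meets the grid only in `0`, because `0` is itself a grid point;
      -- hence the bottom value `w 0 = 0`.
      by_cases hm0 : m = 0
      · have hy0 : y = 0 := by
          refine eq_of_sub_mem hβ hS hy h0 ?_
          rw [hm0] at hm1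
          simpa using hm1
        rw [hy0, canonAbs_zero, Real.zero_rpow hα.ne']
        simp [hw, hm0]
      · simp only [hw, hm0, if_false]
        rw [canonAbs_eq_of_mem_sphere hβ hm1]
        have := Nat.find_min hex (m := m - 1) (by omega)
        convert this using 3
        push_cast [Nat.one_le_iff_ne_zero.2 hm0]
        ring
    rw [hlhs]
    simp only [hmem, ite_not, mul_ite, mul_one, mul_zero]
    rw [← Finset.sum_filter]
    have : (Finset.range (2 * n)).filter (· < m) = Finset.range m := by
      ext k; simp only [Finset.mem_filter, Finset.mem_range]; omega
    rw [this, Finset.sum_range_sub]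
    simp [hw]
  have hsum : ∑ y ∈ grid β S n, ((canonAbs y ^ α : ℝ) : ℂ) * χ (z * y) =
      ∑ k ∈ Finset.range (2 * n), ((w (k + 1) - w k : ℝ) : ℂ) *
        (∑ y ∈ grid β S n, (χ (z * y) : ℂ) -
          ∑ y ∈ grid β S n, if y ∈ ball β ((k : ℤ) - n) then (χ (z * y) : ℂ) else 0) := by
    simp_rw [← Finset.sum_sub_distrib, Finset.mul_sum]
    rw [Finset.sum_comm]
    refine Finset.sum_congr rfl fun y hy => ?_
    rw [hlayer y hy]
    push_cast
    rw [Finset.sum_mul]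
    refine Finset.sum_congr rfl fun k _ => ?_
    split_ifs <;> simp
  rw [rate, hsum, neg_mul, ← mul_neg, ← Finset.sum_neg_distrib]
  refine mul_nonneg ?_ (Finset.sum_nonneg fun k hk => ?_)
  · rw [← Nat.cast_pow, ← Complex.ofReal_natCast, ← Complex.ofReal_inv]
    exact Complex.zero_le_real.2 (by positivity)
  · have hk' := Finset.mem_range.1 hk
    rw [sum_grid_char hβ hS hχ hzB, if_neg hzn, zero_sub, mul_neg, neg_neg,
      sum_grid_char_mul hβ hS hχ (by omega) (by omega) hzB]
    refine mul_nonneg (Complex.zero_le_real.2 (hwmono k)) ?_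
    split_ifs
    · exact Nat.cast_nonneg _
    · exact le_rfl

/-- Fourier inversion on a group of order `q^{2n}`, by orthogonality of characters. -/
theorem sum_rate_mul_char (hβ : IsUniformizer β) (hS : IsRepSystem S) (hχ : IsRankZeroChar β χ)
    (α : ℝ) {n : ℕ} {y : K} (hy : y ∈ grid β S n) :
    ∑ z ∈ grid β S n, rate β S χ α n z * χ (-(z * y)) = -((canonAbs y ^ α : ℝ) : ℂ) := by
  classical
  have hq : (resCard K : ℂ) ^ (2 * n) ≠ 0 :=
    pow_ne_zero _ (Nat.cast_ne_zero.2 resCard_pos.ne')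
  have h1 : ∀ z ∈ grid β S n, rate β S χ α n z * χ (-(z * y)) =
      -((resCard K : ℂ) ^ (2 * n))⁻¹ * ∑ w ∈ grid β S n, ((canonAbs w ^ α : ℝ) : ℂ) *
        χ ((w - y) * z) := by
    intro z _
    rw [rate, mul_assoc, Finset.sum_mul]
    congr 1
    refine Finset.sum_congr rfl fun w _ => ?_
    rw [mul_assoc, ← Circle.coe_mul, ← AddChar.map_add_eq_mul]
    congr 3; ring
  rw [Finset.sum_congr rfl h1, ← Finset.mul_sum, Finset.sum_comm]
  have h2 : ∀ w ∈ grid β S n, ∑ z ∈ grid β S n, ((canonAbs w ^ α : ℝ) : ℂ) * χ ((w - y) * z) =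
      if w = y then ((canonAbs y ^ α : ℝ) : ℂ) * (resCard K : ℂ) ^ (2 * n) else 0 := by
    intro w hw
    have hB : w - y ∈ ball β (n : ℤ) :=
      (ballSubgroup hβ (n : ℤ)).sub_mem (grid_subset_ball hβ hw) (grid_subset_ball hβ hy)
    rw [← Finset.mul_sum, sum_grid_char hβ hS hχ hB]
    by_cases hwy : w = y
    · have : w - y ∈ ball β (-(n : ℤ)) := by
        rw [hwy, sub_self]; exact zero_mem (ballSubgroup hβ _)
      rw [if_pos this, if_pos hwy, hwy]
    · have : w - y ∉ ball β (-(n : ℤ)) := fun h => hwy (eq_of_sub_mem hβ hS hw hy h)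
      rw [if_neg this, if_neg hwy, mul_zero]
  rw [Finset.sum_congr rfl h2, Finset.sum_ite_eq' , if_pos hy]
  field_simp

/-- The jump rate as a nonnegative real number, set to `0` at the origin. -/
def jumpRate (β : 𝒪[K]) (S : Finset 𝒪[K]) (χ : AddChar K Circle) (α : ℝ) (n : ℕ) (z : K) : ℝ :=
  open Classical in
  if z = 0 then 0 else (rate β S χ α n z).re

theorem jumpRate_nonneg (hβ : IsUniformizer β) (hS : IsRepSystem S) (hχ : IsRankZeroChar β χ)
    {α : ℝ} (hα : 0 < α) {n : ℕ} (h0 : (0 : K) ∈ grid β S n) {z : K} (hz : z ∈ grid β S n) :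
    0 ≤ jumpRate β S χ α n z := by
  rw [jumpRate]
  split_ifs with h
  · exact le_rfl
  · exact (Complex.le_def.1 (rate_nonneg hβ hS hχ hα h0 hz h)).1

/-- The Lévy–Khinchin formula: `-|·|^α` is the exponent of the jump rates. -/
theorem sum_jumpRate_mul (hβ : IsUniformizer β) (hS : IsRepSystem S) (hχ : IsRankZeroChar β χ)
    {α : ℝ} (hα : 0 < α) {n : ℕ} (h0 : (0 : K) ∈ grid β S n) {y : K} (hy : y ∈ grid β S n) :
    ∑ z ∈ grid β S n, (jumpRate β S χ α n z : ℂ) * (χ (-(z * y)) - 1) =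
      -((canonAbs y ^ α : ℝ) : ℂ) := by
  -- The factor `χ(-(zy)) - 1` kills `z = 0`, so resetting the rate there is harmless. The
  -- subtracted term is inversion at frequency `0` and contributes `|0|^α = 0`.
  have h1 : ∀ z ∈ grid β S n, (jumpRate β S χ α n z : ℂ) * (χ (-(z * y)) - 1) =
      rate β S χ α n z * χ (-(z * y)) - rate β S χ α n z * χ (-(z * 0)) := by
    intro z hz
    by_cases h : z = 0
    · simp [h]
    · have him := (Complex.le_def.1 (rate_nonneg hβ hS hχ hα h0 hz h)).2
      have : (jumpRate β S χ α n z : ℂ) = rate β S χ α n z := by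
        rw [jumpRate, if_neg h]
        exact Complex.ext (by simp) (by simpa using him)
      rw [this]
      simp [mul_sub]
  rw [Finset.sum_congr rfl h1, Finset.sum_sub_distrib, sum_rate_mul_char hβ hS hχ α hy,
    sum_rate_mul_char hβ hS hχ α h0, canonAbs_zero, Real.zero_rpow hα.ne']
  simp

end Fourier

/-! ### Evaluations are Borel for the Skorokhod topology -/

section Evaluation

variable {K : Type*} [Field K] [ValuativeRel K] [TopologicalSpace K]
  [IsNonarchimedeanLocalField K] {β : 𝒪[K]} {t : ℝ}

theorem isOpen_skorokhod_iff {U : Set (SkorokhodSpace K t)} :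
    IsOpen U ↔ ∀ f ∈ U, ∃ ε > 0, ∀ g, SkorokhodNear ε f g → g ∈ U := Iff.rfl

/-- A time change by less than `η / 2` uses up only half of the margin `η`, and the ultrametric
inequality keeps the same radius `ρ`. -/
theorem isOpen_near_on_interval (hβ : IsUniformizer β) (c d : ℝ) (b : K) {ρ : ℝ} (hρ : 0 < ρ) :
    IsOpen {ω : SkorokhodSpace K t | ∃ η > 0, ∀ r : Set.Icc (0 : ℝ) t,
      c - η ≤ r → (r : ℝ) ≤ d + η → canonAbs (ω.path r - b) < ρ} := by
  rw [isOpen_skorokhod_iff]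
  rintro f ⟨η, hη, hf⟩
  refine ⟨min ρ (η / 2), by positivity, ?_⟩
  rintro g ⟨τ, hτ, hfg⟩
  refine ⟨η / 2, by positivity, fun r hr hr' => ?_⟩
  obtain ⟨s, rfl⟩ := τ.surjective r
  have h1 := abs_lt.1 ((hτ s).trans_le (min_le_right _ _))
  have h2 := hf s (by linarith) (by linarith)
  have h3 := (hfg s).trans_le (min_le_left _ _)
  rw [canonAbs_sub_comm hβ] at h3
  have := canonAbs_add_lt hβ h3 h2
  rwa [sub_add_sub_cancel] at this

/-- Before time `t`, right-continuity replaces closeness at `s` by closeness on `[s + 1/(l+1), s +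
1/(m+1)]` for some `m` and all `l`, which is a countable combination of open events. At time `t` the
event is itself open. -/
theorem measurableSet_path_near (hβ : IsUniformizer β) (s : Set.Icc (0 : ℝ) t) (b : K) {ρ : ℝ}
    (hρ : 0 < ρ) : MeasurableSet {ω : SkorokhodSpace K t | canonAbs (ω.path s - b) < ρ} := by
  by_cases hs : (s : ℝ) = t
  · refine IsOpen.measurableSet ?_
    rw [isOpen_skorokhod_iff]
    intro f hf
    refine ⟨ρ, hρ, ?_⟩
    rintro g ⟨τ, -, hfg⟩
    have hmax : ∀ r : Set.Icc (0 : ℝ) t, r ≤ s := fun r => by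
      rw [← Subtype.coe_le_coe, hs]; exact r.2.2
    -- An increasing bijection fixes the last time.
    have hτ : τ s = s := by
      refine le_antisymm (hmax _) ?_
      calc s = τ (τ.symm s) := (τ.apply_symm_apply s).symm
        _ ≤ τ s := τ.monotone (hmax _)
    have h3 := hfg s
    rw [hτ, canonAbs_sub_comm hβ] at h3
    have := canonAbs_add_lt hβ h3 hf
    rwa [sub_add_sub_cancel] at this
  · have hst : (s : ℝ) < t := lt_of_le_of_ne s.2.2 hs
    have hgt : ∃ r, s < r := ⟨⟨t, s.2.1.trans s.2.2, le_rfl⟩, hst⟩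
    have : {ω : SkorokhodSpace K t | canonAbs (ω.path s - b) < ρ} =
        ⋃ m : ℕ, ⋂ l : ℕ, {ω : SkorokhodSpace K t | ∃ η > 0, ∀ r : Set.Icc (0 : ℝ) t,
          ((s : ℝ) + 1 / ((l : ℝ) + 1)) - η ≤ r → (r : ℝ) ≤ (s + 1 / ((m : ℝ) + 1)) + η →
            canonAbs (ω.path r - b) < ρ} := by
      ext ω
      simp only [Set.mem_iUnion, Set.mem_iInter, Set.mem_ofPred_eq]
      constructor
      · intro h
        have hev : ∀ᶠ r in 𝓝[>] s, canonAbs (ω.path r - b) < ρ := by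
          filter_upwards [ω.rightCont s (canonAbs_lt_mem_nhds hβ hρ (ω.path s))] with r hr
          have := canonAbs_add_lt hβ hr h
          rwa [sub_add_sub_cancel] at this
        obtain ⟨v, hv, hsub⟩ := (mem_nhdsGT_iff_exists_Ioo_subset' hgt.choose_spec).1 hev
        have hv' : (0 : ℝ) < v - s := sub_pos.2 hv
        obtain ⟨m, hm⟩ := exists_nat_one_div_lt (half_pos hv')
        -- This margin keeps the enlarged interval to the right of `s` (inclusive) and to the left
        -- of `v`.
        refine ⟨m, fun l => ⟨min (1 / ((l : ℝ) + 1)) ((v - s) / 2), by positivity, ?_⟩⟩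
        intro r hr hr'
        have h1 : (s : ℝ) ≤ r := by
          have := min_le_left (1 / ((l : ℝ) + 1)) (((v : ℝ) - s) / 2); linarith
        have h2 : (r : ℝ) < v := by
          have := min_le_right (1 / ((l : ℝ) + 1)) (((v : ℝ) - s) / 2); linarith
        rcases eq_or_lt_of_le h1 with h3 | h3
        · rwa [← Subtype.ext h3]
        · exact hsub ⟨h3, h2⟩
      · rintro ⟨m, hm⟩
        have : (𝓝[>] s).NeBot := nhdsGT_neBot_of_exists_gt hgt
        have hlt : ∀ᶠ r : Set.Icc (0 : ℝ) t in 𝓝[>] s, (r : ℝ) < s + 1 / ((m : ℝ) + 1) := by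
          refine nhdsWithin_le_nhds (continuous_subtype_val.continuousAt.eventually_lt
            continuousAt_const ?_)
          have : 0 < 1 / ((m : ℝ) + 1) := by positivity
          linarith
        obtain ⟨r, ⟨hr1, hr2⟩, hr3⟩ := ((hlt.and
          (ω.rightCont s (canonAbs_lt_mem_nhds hβ hρ (ω.path s)))).and self_mem_nhdsWithin).exists
        have hr3' : (0 : ℝ) < r - s := sub_pos.2 hr3
        obtain ⟨l, hl⟩ := exists_nat_one_div_lt hr3'
        obtain ⟨η, hη, h⟩ := hm l
        have h4 := h r (by linarith) (by linarith)
        have hr2' : canonAbs (ω.path s - ω.path r) < ρ := by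
          rw [canonAbs_sub_comm hβ]; exact hr2
        have := canonAbs_add_lt hβ hr2' h4
        rwa [sub_add_sub_cancel] at this
    rw [this]
    exact MeasurableSet.iUnion fun m => MeasurableSet.iInter fun l =>
      (isOpen_near_on_interval hβ _ _ b hρ).measurableSet

theorem measurableSet_path_eq (hβ : IsUniformizer β) (s : Set.Icc (0 : ℝ) t) (b : K) :
    MeasurableSet {ω : SkorokhodSpace K t | ω.path s = b} := by
  have : {ω : SkorokhodSpace K t | ω.path s = b} =
      ⋂ m : ℕ, {ω : SkorokhodSpace K t | canonAbs (ω.path s - b) < 1 / ((m : ℝ) + 1)} := by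
    ext ω
    simp only [Set.mem_iInter, Set.mem_ofPred_eq]
    constructor
    · intro h m
      rw [h, sub_self, canonAbs_zero]
      positivity
    · intro h
      by_contra hne
      obtain ⟨m, hm⟩ := exists_nat_one_div_lt (canonAbs_pos (sub_ne_zero.2 hne))
      exact absurd (h m) (not_lt.2 hm.le)
  rw [this]
  exact MeasurableSet.iInter fun m => measurableSet_path_near hβ s b (by positivity)

end Evaluation

/-! ### Small time changes that move finitely many points -/

section TimeChange

/-- Finitely many distinct points of `(0,t)` can be moved to prescribed nearby points by a small
increasing change of time on `[0,t]`. -/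
theorem eventually_exists_timeChange {t : ℝ} {k : ℕ} {u : Fin k → ℝ}
    (hu : ∀ i, u i ∈ Set.Ioo 0 t) (hinj : Function.Injective u) {ε : ℝ} (hε : 0 < ε) :
    ∀ᶠ u' in 𝓝 u, ∃ τ : Set.Icc (0 : ℝ) t ≃o Set.Icc (0 : ℝ) t,
      (∀ s, |(τ s : ℝ) - s| < ε) ∧ ∀ i (s : Set.Icc (0 : ℝ) t),
        u i ≤ s ↔ u' i ≤ (τ s : ℝ) := by
  by_cases ht : 0 ≤ t
  swap
  · refine Filter.Eventually.of_forall fun u' => ⟨OrderIso.refl _, fun s => ?_, fun i s => ?_⟩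
    all_goals exact absurd (s.2.1.trans s.2.2) ht
  have hsmall : ∀ {c : ℝ}, 0 < c → ∀ᶠ η in 𝓝[>] (0 : ℝ), η < c := fun hc =>
    nhdsWithin_le_nhds (eventually_lt_nhds hc)
  -- A tent of half-width `η` around one `u i` then vanishes at all the other points and at `0` and
  -- `t`.
  have hex : ∀ᶠ η in 𝓝[>] (0 : ℝ), (∀ i, η < u i ∧ η < t - u i) ∧
      ∀ i j, i ≠ j → η < |u i - u j| := by
    refine (Filter.eventually_all.2 fun i => ?_).and
      (Filter.eventually_all.2 fun i => Filter.eventually_all.2 fun j => ?_)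
    · exact (hsmall (hu i).1).and (hsmall (sub_pos.2 (hu i).2))
    · by_cases hij : i = j
      · exact Filter.Eventually.of_forall fun _ h => absurd hij h
      · filter_upwards [hsmall (abs_pos.2 (sub_ne_zero.2 fun h => hij (hinj h)))] with η h _ using h
  obtain ⟨η, ⟨hη1, hη2⟩, hη⟩ := (hex.and self_mem_nhdsWithin).exists
  replace hη : 0 < η := hη
  have hD : ∀ᶠ u' in 𝓝 u, ∑ i, |u' i - u i| < min ε η := by
    have hc : Continuous fun u' : Fin k → ℝ => ∑ i, |u' i - u i| := by fun_prop
    refine hc.continuousAt.eventually_lt continuousAt_const ?_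
    simpa using ⟨hε, hη⟩
  filter_upwards [hD] with u' hu'
  have hD1 := hu'.trans_le (min_le_left _ _)
  have hD2 := hu'.trans_le (min_le_right _ _)
  set D := ∑ i, |u' i - u i| with hDdef
  -- Tents of height `1` and slope `1/η`, weighted by the displacements: `g` sends `u i` to `u' i`
  -- and fixes both ends.
  set φ : Fin k → ℝ → ℝ := fun i s => max 0 (1 - |s - u i| / η) with hφ
  set g : ℝ → ℝ := fun s => s + ∑ i, (u' i - u i) * φ i s with hg
  have hφ0 : ∀ i s, η ≤ |s - u i| → φ i s = 0 := fun i s h => by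
    refine max_eq_left ?_
    have := (one_le_div hη).2 h
    linarith
  have hφ1 : ∀ i s, |φ i s| ≤ 1 := fun i s => by
    have h : 0 ≤ |s - u i| / η := by positivity
    rw [abs_of_nonneg (le_max_left _ _)]
    exact max_le zero_le_one (by linarith)
  have hφL : ∀ i s r, |φ i s - φ i r| ≤ |s - r| / η := fun i s r => by
    refine (abs_max_sub_max_le_max _ _ _ _).trans (max_le (by simp; positivity) ?_)
    rw [show 1 - |s - u i| / η - (1 - |r - u i| / η) = (|r - u i| - |s - u i|) / η by ring,
      abs_div, abs_of_pos hη]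
    refine div_le_div_of_nonneg_right ((abs_abs_sub_abs_le _ _).trans ?_) hη.le
    rw [sub_sub_sub_cancel_right, abs_sub_comm]
  have hgs : ∀ s, |g s - s| < ε := fun s => by
    refine lt_of_le_of_lt ?_ hD1
    simp only [hg, add_sub_cancel_left]
    refine (Finset.abs_sum_le_sum_abs _ _).trans (Finset.sum_le_sum fun i _ => ?_)
    rw [abs_mul]
    exact mul_le_of_le_one_right (abs_nonneg _) (hφ1 i s)
  -- The perturbation of the identity has Lipschitz constant at most `D/η < 1`, even where tents
  -- overlap.
  have hmono : StrictMono g := by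
    intro r s hrs
    have h1 : |∑ i, (u' i - u i) * φ i s - ∑ i, (u' i - u i) * φ i r| ≤ D * (|s - r| / η) := by
      rw [← Finset.sum_sub_distrib, hDdef, Finset.sum_mul]
      refine (Finset.abs_sum_le_sum_abs _ _).trans (Finset.sum_le_sum fun i _ => ?_)
      rw [← mul_sub, abs_mul]
      gcongr
      exact hφL i s r
    have h2 : D * (|s - r| / η) < s - r := by
      have hsr : 0 < s - r := sub_pos.2 hrs
      rw [abs_of_pos hsr, mul_div_assoc', div_lt_iff₀ hη, mul_comm (s - r)]
      exact mul_lt_mul_of_pos_right hD2 hsr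
    have h3 := (abs_le.1 h1).1
    simp only [hg]
    linarith
  have hcont : Continuous g := by
    simp only [hg, hφ]
    fun_prop
  have hg0 : g 0 = 0 := by
    have : ∀ i, φ i 0 = 0 := fun i => hφ0 i 0 (by
      rw [zero_sub, abs_neg]; exact (hη1 i).1.le.trans (le_abs_self _))
    simp [hg, this]
  have hgt : g t = t := by
    have : ∀ i, φ i t = 0 := fun i => hφ0 i t ((hη1 i).2.le.trans (le_abs_self _))
    simp [hg, this]
  have hgu : ∀ i, g (u i) = u' i := fun i => by
    simp only [hg]
    rw [Finset.sum_eq_single i]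
    · simp [hφ]
    · intro j _ hji
      rw [hφ0 j (u i) (hη2 i j hji.symm).le, mul_zero]
    · simp
  have hmaps : ∀ s : Set.Icc (0 : ℝ) t, g s ∈ Set.Icc (0 : ℝ) t := fun s => by
    constructor
    · exact hg0.symm.le.trans (hmono.monotone s.2.1)
    · exact (hmono.monotone s.2.2).trans hgt.le
  let G : Set.Icc (0 : ℝ) t → Set.Icc (0 : ℝ) t := fun s => ⟨g s, hmaps s⟩
  have hG : StrictMono G := fun r s hrs => hmono hrs
  have hGs : Function.Surjective G := by
    intro y
    have := intermediate_value_Icc ht hcont.continuousOn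
    rw [hg0, hgt] at this
    obtain ⟨x, hx, hxy⟩ := this y.2
    exact ⟨⟨x, hx⟩, Subtype.ext hxy⟩
  refine ⟨hG.orderIsoOfSurjective G hGs, fun s => hgs s, fun i s => ?_⟩
  rw [← hgu i]
  exact (hmono.le_iff_le).symm

end TimeChange

/-! ### Step paths as functions of their jump times -/

section JumpPath

variable {K : Type*} [Field K]

/-- The sum of the jumps `z i` whose times `u i` lie in `(0, s] ∩ (0, t)`. -/
def jumpSum (t : ℝ) {k : ℕ} (z : Fin k → K) (u : Fin k → ℝ) (s : ℝ) : K :=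
  open Classical in
  ∑ i, if 0 < u i ∧ u i ≤ s ∧ u i < t then z i else 0

theorem jumpSum_congr {t : ℝ} {k : ℕ} (z : Fin k → K) {u u' : Fin k → ℝ} {s s' : ℝ}
    (h : ∀ i, (0 < u i ∧ u i ≤ s ∧ u i < t) ↔ (0 < u' i ∧ u' i ≤ s' ∧ u' i < t)) :
    jumpSum t z u s = jumpSum t z u' s' := by
  classical
  exact Finset.sum_congr rfl fun i _ => if_congr (h i) rfl rfl

/-- The left limit of `jumpSum` at `s`. -/
def jumpSumLeft (t : ℝ) {k : ℕ} (z : Fin k → K) (u : Fin k → ℝ) (s : ℝ) : K :=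
  open Classical in
  ∑ i, if 0 < u i ∧ u i < s ∧ u i < t then z i else 0

theorem eventually_jumpSum_right {t : ℝ} {k : ℕ} (z : Fin k → K) (u : Fin k → ℝ)
    (s : Set.Icc (0 : ℝ) t) :
    ∀ᶠ r : Set.Icc (0 : ℝ) t in 𝓝[>] s, jumpSum t z u r = jumpSum t z u s := by
  have h : ∀ᶠ r : Set.Icc (0 : ℝ) t in 𝓝[>] s, ∀ i, u i ≤ r ↔ u i ≤ s := by
    refine Filter.eventually_all.2 fun i => ?_
    by_cases hi : u i ≤ s
    · filter_upwards [self_mem_nhdsWithin] with r hr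
      have hr' : (s : ℝ) < r := hr
      simp only [hi, iff_true]
      linarith
    · push Not at hi
      have : ∀ᶠ r : Set.Icc (0 : ℝ) t in 𝓝[>] s, (r : ℝ) < u i :=
        nhdsWithin_le_nhds (continuous_subtype_val.continuousAt.eventually_lt continuousAt_const hi)
      filter_upwards [this] with r hr
      simp only [not_le.2 hr, not_le.2 hi]
  filter_upwards [h] with r hr
  exact jumpSum_congr z fun i => by rw [hr i]

theorem eventually_jumpSum_left {t : ℝ} {k : ℕ} (z : Fin k → K) (u : Fin k → ℝ)
    (s : Set.Icc (0 : ℝ) t) :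
    ∀ᶠ r : Set.Icc (0 : ℝ) t in 𝓝[<] s, jumpSum t z u r = jumpSumLeft t z u s := by
  have h : ∀ᶠ r : Set.Icc (0 : ℝ) t in 𝓝[<] s, ∀ i, u i ≤ r ↔ u i < s := by
    refine Filter.eventually_all.2 fun i => ?_
    by_cases hi : u i < s
    · have : ∀ᶠ r : Set.Icc (0 : ℝ) t in 𝓝[<] s, u i < (r : ℝ) :=
        nhdsWithin_le_nhds (continuousAt_const.eventually_lt continuous_subtype_val.continuousAt hi)
      filter_upwards [this] with r hr
      simp only [hr.le, hi]
    · filter_upwards [self_mem_nhdsWithin] with r hr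
      have hr' : (r : ℝ) < s := hr
      simp only [hi, iff_false, not_le]
      push Not at hi
      linarith
  filter_upwards [h] with r hr
  classical
  exact Finset.sum_congr rfl fun i _ => if_congr (by rw [hr i]) rfl rfl

variable [ValuativeRel K] [TopologicalSpace K] [IsNonarchimedeanLocalField K]
  {β : 𝒪[K]} {S : Finset 𝒪[K]}

/-- The step path on the grid that starts at `a` and jumps by `z i` at time `u i`. -/
def jumpPath (β : 𝒪[K]) (S : Finset 𝒪[K]) (n : ℕ) (a : K) (t : ℝ) {k : ℕ} (z : Fin k → K)
    (u : Fin k → ℝ) : SkorokhodSpace K t where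
  path s := gridRep β S n (a + jumpSum t z u s)
  rightCont s := tendsto_const_nhds.congr' <| by
    filter_upwards [eventually_jumpSum_right z u s] with r hr
    rw [hr]
  leftLim s := ⟨gridRep β S n (a + jumpSumLeft t z u s), tendsto_const_nhds.congr' <| by
    filter_upwards [eventually_jumpSum_left z u s] with r hr
    rw [hr]⟩
  -- Jumps at time `t` are discarded by the condition `u i < t`, so the value at `t` is the left
  -- limit.
  leftContEnd s hs := tendsto_const_nhds.congr' <| by
    filter_upwards [eventually_jumpSum_left z u s] with r hr
    rw [hr]
    congr 2
    classical
    refine Finset.sum_congr rfl fun i _ => if_congr ?_ rfl rfl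
    rw [hs]
    exact ⟨fun h => ⟨h.1, h.2.2, h.2.2⟩, fun h => ⟨h.1, h.2.2.le, h.2.2⟩⟩

/-- A small time change carries the jump times `u` to the nearby `u'`; after it the two paths
coincide exactly. -/
theorem continuousAt_jumpPath (n : ℕ) (a : K) {t : ℝ} {k : ℕ} (z : Fin k → K) {u : Fin k → ℝ}
    (hu : ∀ i, u i ∈ Set.Ioo 0 t) (hinj : Function.Injective u) :
    ContinuousAt (jumpPath β S n a t z) u := by
  rw [ContinuousAt, Filter.tendsto_def]
  intro A hA
  obtain ⟨U, hUA, hU, huU⟩ := mem_nhds_iff.1 hA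
  obtain ⟨ε, hε, h⟩ := isOpen_skorokhod_iff.1 hU _ huU
  have hev : ∀ᶠ u' in 𝓝 u, ∀ i, u' i ∈ Set.Ioo 0 t := by
    refine Filter.eventually_all.2 fun i => ?_
    exact (continuous_apply i).continuousAt (isOpen_Ioo.mem_nhds (hu i))
  filter_upwards [hev, eventually_exists_timeChange hu hinj hε] with u' hu' hτ
  obtain ⟨τ, hτ1, hτ2⟩ := hτ
  refine hUA (h _ ⟨τ, hτ1, fun s => ?_⟩)
  have : jumpSum t z u s = jumpSum t z u' (τ s) := jumpSum_congr z fun i => by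
    simp only [(hu i).1, (hu i).2, (hu' i).1, (hu' i).2, hτ2 i s]
  simp only [jumpPath, this, sub_self, canonAbs_zero]
  exact hε

theorem volume_eq_coord {k : ℕ} {i j : Fin k} (hij : i ≠ j) :
    MeasureTheory.volume {u : Fin k → ℝ | u i = u j} = 0 := by
  let L : (Fin k → ℝ) →ₗ[ℝ] ℝ := 
    LinearMap.proj (R := ℝ) (φ := fun _ => ℝ) i - LinearMap.proj (R := ℝ) (φ := fun _ => ℝ) j
  have h : {u : Fin k → ℝ | u i = u j} = (LinearMap.ker L : Set (Fin k → ℝ)) := by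
    ext u
    simp [L, sub_eq_zero]
  rw [h]
  refine MeasureTheory.Measure.addHaar_submodule _ _ fun htop => ?_
  have : L (Pi.single i 1) = 0 := by
    rw [← LinearMap.mem_ker, htop]; trivial
  simp [L, hij.symm] at this

/-- Coinciding jump times fill finitely many hyperplanes, a null set, off which the map is
continuous. -/
theorem aemeasurable_jumpPath (n : ℕ) (a : K) {t : ℝ} {k : ℕ} (z : Fin k → K) :
    AEMeasurable (jumpPath β S n a t z)
      (MeasureTheory.volume.restrict (Set.univ.pi fun _ => Set.Ioo 0 t)) := by
  set I : Set (Fin k → ℝ) := Set.univ.pi fun _ => Set.Ioo 0 t with hI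
  set E : Set (Fin k → ℝ) := ⋃ i, ⋃ j, ⋃ _ : i ≠ j, {u | u i = u j} with hE
  have hImeas : MeasurableSet I := MeasurableSet.univ_pi fun _ => measurableSet_Ioo
  have hEmeas : MeasurableSet E := MeasurableSet.iUnion fun i => MeasurableSet.iUnion fun j =>
    MeasurableSet.iUnion fun _ =>
      measurableSet_eq_fun (measurable_pi_apply i) (measurable_pi_apply j)
  have hE0 : MeasureTheory.volume E = 0 := by
    simp only [hE, MeasureTheory.measure_iUnion_null_iff]
    exact fun i j hij => volume_eq_coord hij
  have hae : (I \ E : Set (Fin k → ℝ)) =ᵐ[MeasureTheory.volume] I :=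
    MeasureTheory.sdiff_null_ae_eq_self hE0
  rw [← MeasureTheory.Measure.restrict_congr_set hae]
  refine ContinuousOn.aemeasurable (fun u hu => ?_) (hImeas.diff hEmeas)
  refine (continuousAt_jumpPath n a z (fun i => hu.1 i trivial) fun i j hij => ?_).continuousWithinAt
  by_contra hne
  exact hu.2 (Set.mem_iUnion.2 ⟨i, Set.mem_iUnion.2 ⟨j, Set.mem_iUnion.2 ⟨hne, hij⟩⟩⟩)

end JumpPath

/-! ### Integrating over a single jump time -/

section IntervalProducts

variable {N : ℕ} {σ : Fin (N + 1) → ℝ}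

/-- The intervals are disjoint, so at most one factor differs from `1`; the product becomes a sum
that integrates term by term. -/
theorem prod_ite_eq_one_add_sum (hσ : Monotone σ) (w : Fin N → ℂ) (u : ℝ) :
    ∏ i : Fin N, (if u ∈ Set.Ioc (σ i.castSucc) (σ i.succ) then w i else 1) =
      1 + ∑ i : Fin N, (Set.Ioc (σ i.castSucc) (σ i.succ)).indicator (fun _ => w i - 1) u := by
  have hdisj : ∀ i j : Fin N, u ∈ Set.Ioc (σ i.castSucc) (σ i.succ) →
      u ∈ Set.Ioc (σ j.castSucc) (σ j.succ) → ¬ i < j := by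
    intro i j hi hj hij
    have h : σ i.succ ≤ σ j.castSucc := hσ (by
      rw [Fin.le_def, Fin.val_succ, Fin.val_castSucc]; exact hij)
    exact absurd (hi.2.trans h) (not_le.2 hj.1)
  by_cases hex : ∃ i : Fin N, u ∈ Set.Ioc (σ i.castSucc) (σ i.succ)
  · obtain ⟨i, hi⟩ := hex
    have hne : ∀ j : Fin N, j ≠ i → u ∉ Set.Ioc (σ j.castSucc) (σ j.succ) := fun j hji hj =>
      (lt_or_gt_of_ne hji).elim (hdisj j i hj hi) (hdisj i j hi hj)
    rw [Finset.prod_eq_single i (fun j _ hj => if_neg (hne j hj)) (by simp), if_pos hi,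
      Finset.sum_eq_single i (fun j _ hj => Set.indicator_of_notMem (hne j hj) _) (by simp),
      Set.indicator_of_mem hi]
    ring
  · push Not at hex
    rw [Finset.prod_eq_one fun i _ => if_neg (hex i),
      Finset.sum_eq_zero fun i _ => Set.indicator_of_notMem (hex i) _, add_zero]

theorem integrable_prod_ite (hσ : Monotone σ) (t : ℝ) (w : Fin N → ℂ) :
    MeasureTheory.Integrable
      (fun u : ℝ => ∏ i : Fin N, (if u ∈ Set.Ioc (σ i.castSucc) (σ i.succ) then w i else 1))
      (MeasureTheory.volume.restrict (Set.Ioo 0 t)) := by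
  simp_rw [prod_ite_eq_one_add_sum hσ]
  refine (MeasureTheory.integrable_const _).add (MeasureTheory.integrable_finsetSum _ fun i _ => ?_)
  exact (MeasureTheory.integrable_const _).indicator measurableSet_Ioc

theorem integral_prod_ite (hσ : Monotone σ) {t : ℝ} (ht : 0 ≤ t) (hσ0 : 0 ≤ σ 0)
    (hσt : ∀ j, σ j ≤ t) (w : Fin N → ℂ) :
    ∫ u in Set.Ioo 0 t, ∏ i : Fin N,
        (if u ∈ Set.Ioc (σ i.castSucc) (σ i.succ) then w i else 1) =
      t + ∑ i : Fin N, ((σ i.succ - σ i.castSucc : ℝ) : ℂ) * (w i - 1) := by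
  simp_rw [prod_ite_eq_one_add_sum hσ]
  rw [MeasureTheory.integral_add (MeasureTheory.integrable_const _)
    (MeasureTheory.integrable_finsetSum _ fun i _ =>
      (MeasureTheory.integrable_const _).indicator measurableSet_Ioc),
    MeasureTheory.integral_finsetSum _ fun i _ =>
      (MeasureTheory.integrable_const _).indicator measurableSet_Ioc]
  congr 1
  · simp [MeasureTheory.measureReal_def, ht]
  · refine Finset.sum_congr rfl fun i _ => ?_
    have hle : σ i.castSucc ≤ σ i.succ := hσ (Fin.castSucc_lt_succ).le
    have hsub : Set.Ioc (σ i.castSucc) (σ i.succ) ∩ Set.Ioc 0 t =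
        Set.Ioc (σ i.castSucc) (σ i.succ) :=
      Set.inter_eq_left.2 (Set.Ioc_subset_Ioc (hσ0.trans (hσ (Fin.zero_le _))) (hσt _))
    rw [MeasureTheory.Measure.restrict_congr_set MeasureTheory.Ioo_ae_eq_Ioc,
      MeasureTheory.integral_indicator_const _ measurableSet_Ioc, MeasureTheory.measureReal_def,
      MeasureTheory.Measure.restrict_apply measurableSet_Ioc, hsub, Real.volume_Ioc,
      ENNReal.toReal_ofReal (sub_nonneg.2 hle), Complex.real_smul]

end IntervalProducts

/-! ### The compound Poisson law and its finite-dimensional distributions -/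

section WalkMeasure

theorem jumpSum_sub {K : Type*} [Field K] {t : ℝ} {k : ℕ} (z : Fin k → K) {u : Fin k → ℝ}
    (hu : ∀ l, u l ∈ Set.Ioo 0 t) {r s : ℝ} (hrs : r ≤ s) :
    jumpSum t z u s - jumpSum t z u r = ∑ l, if u l ∈ Set.Ioc r s then z l else 0 := by
  classical
  rw [jumpSum, jumpSum, ← Finset.sum_sub_distrib]
  refine Finset.sum_congr rfl fun l _ => ?_
  simp only [(hu l).1, (hu l).2, true_and, and_true, Set.mem_Ioc]
  by_cases h1 : u l ≤ r
  · simp [h1, h1.trans hrs, not_lt.2 h1]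
  · by_cases h2 : u l ≤ s
    · simp [h1, h2, not_le.1 h1]
    · simp [h1, h2]

theorem jumpSum_zero {K : Type*} [Field K] (t : ℝ) {k : ℕ} (z : Fin k → K) (u : Fin k → ℝ) :
    jumpSum t z u 0 = 0 := by
  classical
  refine Finset.sum_eq_zero fun i _ => if_neg ?_
  rintro ⟨h1, h2, -⟩
  linarith

theorem char_sum {A M ι : Type*} [AddCommMonoid A] [CommMonoid M] (ψ : AddChar A M) (s : Finset ι)
    (f : ι → A) : ψ (∑ i ∈ s, f i) = ∏ i ∈ s, ψ (f i) := by
  classical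
  induction s using Finset.induction_on with
  | empty => simp
  | insert i s hi ih => rw [Finset.sum_insert hi, Finset.prod_insert hi, AddChar.map_add_eq_mul, ih]

/-- Telescoping. It replaces conditions on positions by conditions on increments, each of which gets
its own frequency in the Fourier expansion. -/
theorem forall_succ_mem_iff {G : Type*} [AddCommGroup G] (H : AddSubgroup G) {N : ℕ}
    (e : Fin (N + 1) → G) (h0 : e 0 ∈ H) :
    (∀ i : Fin N, e i.succ ∈ H) ↔ ∀ i : Fin N, e i.succ - e i.castSucc ∈ H := by
  constructor
  · intro h i
    have hall : ∀ j, e j ∈ H := fun j => Fin.cases h0 h j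
    exact H.sub_mem (hall _) (hall _)
  · intro h i
    have hall : ∀ j, e j ∈ H := fun j => by
      induction j using Fin.induction with
      | zero => exact h0
      | succ i ih => simpa using H.add_mem (h i) ih
    exact hall _

variable {K : Type*} [Field K] [ValuativeRel K] [TopologicalSpace K]
  [IsNonarchimedeanLocalField K] {β : 𝒪[K]} {S : Finset 𝒪[K]} {χ : AddChar K Circle}

theorem jumpSum_mem_ball (hβ : IsUniformizer β) {n : ℕ} {t : ℝ} {k : ℕ} {z : Fin k → K}
    (hz : ∀ l, z l ∈ grid β S n) (u : Fin k → ℝ) (s : ℝ) :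
    jumpSum t z u s ∈ ball β (n : ℤ) := by
  classical
  refine (ballSubgroup hβ (n : ℤ)).sum_mem fun i _ => ?_
  split_ifs
  · exact grid_subset_ball hβ (hz i)
  · exact zero_mem _

/-- Fourier expansion of the event that a jump path visits given grid points at given times. -/
theorem indicator_jumpPath (hβ : IsUniformizer β) (hS : IsRepSystem S) (hχ : IsRankZeroChar β χ)
    {n : ℕ} {t : ℝ} {k : ℕ} {z : Fin k → K} (hz : ∀ l, z l ∈ grid β S n)
    {u : Fin k → ℝ} (hu : ∀ l, u l ∈ Set.Ioo 0 t) {N : ℕ} {σ : Fin (N + 1) → ℝ} (hσ : Monotone σ)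
    (hσ0 : σ 0 = 0) {b : Fin (N + 1) → K} (hb : ∀ j, b j ∈ grid β S n) :
    open Classical in
    (if ∀ i : Fin N, gridRep β S n (b 0 + jumpSum t z u (σ i.succ)) = b i.succ
      then (1 : ℂ) else 0) =
      ((resCard K : ℂ) ^ (2 * n * N))⁻¹ * ∑ y ∈ Fintype.piFinset fun _ : Fin N => grid β S n,
        (∏ i : Fin N, (χ ((b i.succ - b i.castSucc) * y i) : ℂ)) *
          ∏ l : Fin k, ∏ i : Fin N, (if u l ∈ Set.Ioc (σ i.castSucc) (σ i.succ)
            then (χ (-(z l * y i)) : ℂ) else 1) := by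
  classical
  set A : ℝ → K := jumpSum t z u with hA
  have hAB : ∀ s, A s ∈ ball β (n : ℤ) := fun s => jumpSum_mem_ball hβ hz u s
  have hbB : ∀ j, b j ∈ ball β (n : ℤ) := fun j => grid_subset_ball hβ (hb j)
  -- The deviation of the unreduced walk from its targets; a target is hit when it lies in `B_{-n}`.
  set e : Fin (N + 1) → K := fun j => b 0 + A (σ j) - b j with he
  have he0 : e 0 ∈ ballSubgroup hβ (-(n : ℤ)) := by
    simp only [he, hA, hσ0, jumpSum_zero, add_zero, sub_self]
    exact zero_mem _
  have heB : ∀ j, e j ∈ ballSubgroup hβ (n : ℤ) := fun j =>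
    AddSubgroup.sub_mem _ (AddSubgroup.add_mem _ (hbB 0) (hAB _)) (hbB j)
  have hiff : (∀ i : Fin N, gridRep β S n (b 0 + A (σ i.succ)) = b i.succ) ↔
      ∀ i : Fin N, e i.succ - e i.castSucc ∈ ball β (-(n : ℤ)) := by
    refine Iff.trans (forall_congr' fun i => ?_)
      (forall_succ_mem_iff (ballSubgroup hβ (-(n : ℤ))) e he0)
    exact gridRep_eq_iff hβ hS (AddSubgroup.add_mem (ballSubgroup hβ (n : ℤ)) (hbB 0) (hAB _)) (hb _)
  -- Orthogonality of characters. The sign makes the target increments appear as `χ((b_i -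
  -- b_{i-1})y)`, as in the densities.
  have hfac : ∀ i : Fin N, (if e i.succ - e i.castSucc ∈ ball β (-(n : ℤ)) then (1 : ℂ) else 0) =
      ((resCard K : ℂ) ^ (2 * n))⁻¹ *
        ∑ y ∈ grid β S n, (χ (-(e i.succ - e i.castSucc) * y) : ℂ) := by
    intro i
    have hq : (resCard K : ℂ) ^ (2 * n) ≠ 0 :=
      pow_ne_zero _ (Nat.cast_ne_zero.2 resCard_pos.ne')
    rw [sum_grid_char hβ hS hχ ((ballSubgroup hβ (n : ℤ)).neg_mem
      ((ballSubgroup hβ (n : ℤ)).sub_mem (heB _) (heB _)))]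
    have : -(e i.succ - e i.castSucc) ∈ ball β (-(n : ℤ)) ↔
        e i.succ - e i.castSucc ∈ ball β (-(n : ℤ)) :=
      (ballSubgroup hβ (-(n : ℤ))).neg_mem_iff
    simp only [this]
    split_ifs
    · exact (inv_mul_cancel₀ hq).symm
    · rw [mul_zero]
  have hchar : ∀ (i : Fin N) (y : K), (χ (-(e i.succ - e i.castSucc) * y) : ℂ) =
      χ ((b i.succ - b i.castSucc) * y) * ∏ l : Fin k,
        (if u l ∈ Set.Ioc (σ i.castSucc) (σ i.succ) then (χ (-(z l * y)) : ℂ) else 1) := by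
    intro i y
    have h1 : -(e i.succ - e i.castSucc) * y = (b i.succ - b i.castSucc) * y +
        ∑ l, if u l ∈ Set.Ioc (σ i.castSucc) (σ i.succ) then -(z l * y) else 0 := by
      have h2 : (∑ l, if u l ∈ Set.Ioc (σ i.castSucc) (σ i.succ) then -(z l * y) else 0) =
          -(A (σ i.succ) - A (σ i.castSucc)) * y := by
        rw [hA, jumpSum_sub z hu (hσ (Fin.castSucc_lt_succ).le), ← Finset.sum_neg_distrib,
          Finset.sum_mul]
        refine Finset.sum_congr rfl fun l _ => ?_
        split_ifs <;> ring
      rw [h2]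
      simp only [he]
      ring
    rw [h1, AddChar.map_add_eq_mul, char_sum, Circle.coe_mul]
    congr 1
    refine (map_prod Circle.coeHom _ _).trans (Finset.prod_congr rfl fun l _ => ?_)
    split_ifs
    · rfl
    · simp
  have hprod : (if ∀ i : Fin N, e i.succ - e i.castSucc ∈ ball β (-(n : ℤ)) then (1 : ℂ) else 0) =
      ∏ i : Fin N, (if e i.succ - e i.castSucc ∈ ball β (-(n : ℤ)) then (1 : ℂ) else 0) := by
    rw [Finset.prod_ite_zero]
    simp
  simp only [hiff]
  rw [hprod, Finset.prod_congr rfl fun i _ => hfac i, Finset.prod_mul_distrib, Finset.prod_const,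
    Finset.card_univ, Fintype.card_fin, inv_pow, ← pow_mul, Finset.prod_univ_sum]
  congr 1
  refine Finset.sum_congr rfl fun y _ => ?_
  rw [Finset.prod_congr rfl fun i _ => hchar i (y i), Finset.prod_mul_distrib, Finset.prod_comm]

theorem measurableSet_cylinder (hβ : IsUniformizer β) {t : ℝ} {N : ℕ}
    (τ : Fin N → Set.Icc (0 : ℝ) t) (b : Fin N → K) :
    MeasurableSet {ω : SkorokhodSpace K t | ∀ i, ω.path (τ i) = b i} := by
  have : {ω : SkorokhodSpace K t | ∀ i, ω.path (τ i) = b i} =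
      ⋂ i, {ω : SkorokhodSpace K t | ω.path (τ i) = b i} := by
    ext ω; simp
  rw [this]
  exact MeasurableSet.iInter fun i => measurableSet_path_eq hβ _ _

theorem monotone_cons_zero {t : ℝ} {N : ℕ} {τ : Fin N → Set.Icc (0 : ℝ) t} (hτ : Monotone τ) :
    Monotone (Fin.cons 0 (fun i => (τ i : ℝ)) : Fin (N + 1) → ℝ) := by
  rw [Fin.monotone_iff_le_succ]
  intro i
  rw [Fin.cons_succ]
  obtain ⟨j, hj⟩ | hi : (∃ j : Fin N, i.castSucc = j.succ) ∨ i.castSucc = 0 := by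
    rcases Fin.eq_zero_or_eq_succ i.castSucc with h | h
    · exact Or.inr h
    · exact Or.inl h
  · rw [hj, Fin.cons_succ]
    refine hτ ?_
    have := congrArg Fin.val hj
    rw [Fin.val_castSucc, Fin.val_succ] at this
    rw [Fin.le_def]; omega
  · rw [hi, Fin.cons_zero]
    exact (τ i).2.1

theorem cons_zero_le {t : ℝ} (ht : 0 ≤ t) {N : ℕ} (τ : Fin N → Set.Icc (0 : ℝ) t)
    (j : Fin (N + 1)) : (Fin.cons 0 (fun i => (τ i : ℝ)) : Fin (N + 1) → ℝ) j ≤ t := by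
  refine Fin.cases ht (fun i => ?_) j
  rw [Fin.cons_succ]
  exact (τ i).2.2

/-- The mass of a cylinder under independent uniformly distributed jump times. -/
theorem volume_jumpPath_cylinder (hβ : IsUniformizer β) (hS : IsRepSystem S)
    (hχ : IsRankZeroChar β χ) {n : ℕ} {t : ℝ} (ht : 0 ≤ t) {k : ℕ} {z : Fin k → K}
    (hz : ∀ l, z l ∈ grid β S n) {N : ℕ} {τ : Fin N → Set.Icc (0 : ℝ) t} (hτ : Monotone τ)
    {a : K} (ha : a ∈ grid β S n) {b : Fin N → K} (hb : ∀ i, b i ∈ grid β S n)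
    {σ : Fin (N + 1) → ℝ} (hσ : σ = Fin.cons 0 fun i => (τ i : ℝ)) {b' : Fin (N + 1) → K}
    (hb' : b' = Fin.cons a b) :
    (((MeasureTheory.volume.restrict (Set.univ.pi fun _ : Fin k => Set.Ioo 0 t)).real
      (jumpPath β S n a t z ⁻¹' {ω | ∀ i, ω.path (τ i) = b i}) : ℝ) : ℂ) =
      ((resCard K : ℂ) ^ (2 * n * N))⁻¹ * ∑ y ∈ Fintype.piFinset fun _ : Fin N => grid β S n,
        (∏ i : Fin N, (χ ((b' i.succ - b' i.castSucc) * y i) : ℂ)) *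
          ∏ l : Fin k, (t + ∑ i : Fin N, ((σ i.succ - σ i.castSucc : ℝ) : ℂ) *
            (χ (-(z l * y i)) - 1)) := by
  classical
  have hmono : Monotone σ := by rw [hσ]; exact monotone_cons_zero hτ
  have hσ0 : σ 0 = 0 := by rw [hσ, Fin.cons_zero]
  have hσt : ∀ j, σ j ≤ t := by rw [hσ]; exact cons_zero_le ht τ
  have hbg : ∀ j, b' j ∈ grid β S n := by
    intro j
    rw [hb']
    refine Fin.cases ?_ (fun i => ?_) j
    · rwa [Fin.cons_zero]
    · rw [Fin.cons_succ]; exact hb i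
  set μ := MeasureTheory.volume.restrict (Set.univ.pi fun _ : Fin k => Set.Ioo 0 t) with hμ
  have hμpi : μ = MeasureTheory.Measure.pi
      fun _ : Fin k => (MeasureTheory.volume : MeasureTheory.Measure ℝ).restrict (Set.Ioo 0 t) := by
    rw [hμ, ← MeasureTheory.Measure.restrict_pi_pi]; rfl
  have hnull : MeasureTheory.NullMeasurableSet
      (jumpPath β S n a t z ⁻¹' {ω | ∀ i, ω.path (τ i) = b i}) μ :=
    (aemeasurable_jumpPath n a z).nullMeasurableSet_preimage (measurableSet_cylinder hβ τ b)
  have hint : ((μ.real (jumpPath β S n a t z ⁻¹' {ω | ∀ i, ω.path (τ i) = b i}) : ℝ) : ℂ) =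
      ∫ u, (jumpPath β S n a t z ⁻¹' {ω | ∀ i, ω.path (τ i) = b i}).indicator
        (fun _ => (1 : ℂ)) u ∂μ := by
    rw [MeasureTheory.integral_indicator₀ hnull, MeasureTheory.setIntegral_const,
      Complex.real_smul, mul_one]
  have hcongr : ∀ u ∈ Set.univ.pi fun _ : Fin k => Set.Ioo 0 t,
      (jumpPath β S n a t z ⁻¹' {ω | ∀ i, ω.path (τ i) = b i}).indicator (fun _ => (1 : ℂ)) u =
      ((resCard K : ℂ) ^ (2 * n * N))⁻¹ * ∑ y ∈ Fintype.piFinset fun _ : Fin N => grid β S n,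
        (∏ i : Fin N, (χ ((b' i.succ - b' i.castSucc) * y i) : ℂ)) *
          ∏ l : Fin k, ∏ i : Fin N, (if u l ∈ Set.Ioc (σ i.castSucc) (σ i.succ)
            then (χ (-(z l * y i)) : ℂ) else 1) := by
    intro u hu
    rw [← indicator_jumpPath hβ hS hχ hz (fun l => hu l trivial) hmono hσ0 hbg, Set.indicator]
    refine if_congr ?_ rfl rfl
    simp only [Set.mem_preimage, Set.mem_ofPred_eq, jumpPath, hσ, hb', Fin.cons_succ, Fin.cons_zero]
  rw [hint, hμ, MeasureTheory.setIntegral_congr_fun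
    (MeasurableSet.univ_pi fun _ => measurableSet_Ioo) hcongr, ← hμ, hμpi,
    MeasureTheory.integral_const_mul, MeasureTheory.integral_finsetSum]
  · congr 1
    refine Finset.sum_congr rfl fun y _ => ?_
    rw [MeasureTheory.integral_const_mul]
    congr 1
    -- Each factor depends on one jump time only, so the integral over the cube factorises over the
    -- jumps.
    rw [MeasureTheory.integral_fintype_prod_eq_prod (fun (l : Fin k) (v : ℝ) => ∏ i : Fin N,
      (if v ∈ Set.Ioc (σ i.castSucc) (σ i.succ) then (χ (-(z l * y i)) : ℂ) else 1))]
    exact Finset.prod_congr rfl fun l _ => integral_prod_ite hmono ht hσ0.ge hσt _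
  · intro y _
    exact (MeasureTheory.Integrable.fintype_prod fun l =>
      integrable_prod_ite hmono t fun i => (χ (-(z l * y i)) : ℂ)).const_mul _

/-- The unnormalised law of the walk restricted to paths with `k` jumps. -/
def jumpMeasure (β : 𝒪[K]) (S : Finset 𝒪[K]) (χ : AddChar K Circle) (α : ℝ) (n : ℕ) (a : K) (t : ℝ)
    (k : ℕ) : MeasureTheory.Measure (SkorokhodSpace K t) :=
  ∑ z ∈ Fintype.piFinset fun _ : Fin k => grid β S n,
    ENNReal.ofReal (∏ l, jumpRate β S χ α n (z l)) •
      (MeasureTheory.volume.restrict (Set.univ.pi fun _ : Fin k => Set.Ioo 0 t)).map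
        (jumpPath β S n a t z)

/-- The law of the walk: a compound Poisson process on the grid. -/
def walkMeasure (β : 𝒪[K]) (S : Finset 𝒪[K]) (χ : AddChar K Circle) (α : ℝ) (n : ℕ) (a : K)
    (t : ℝ) : MeasureTheory.Measure (SkorokhodSpace K t) :=
  MeasureTheory.Measure.sum fun k : ℕ =>
    ENNReal.ofReal (Real.exp (-((∑ z ∈ grid β S n, jumpRate β S χ α n z) * t)) / k.factorial) •
      jumpMeasure β S χ α n a t k

theorem jumpMeasure_apply (α : ℝ) (n : ℕ) (a : K) (t : ℝ) (k : ℕ) {A : Set (SkorokhodSpace K t)}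
    (hA : MeasurableSet A) :
    jumpMeasure β S χ α n a t k A = ∑ z ∈ Fintype.piFinset fun _ : Fin k => grid β S n,
      ENNReal.ofReal (∏ l, jumpRate β S χ α n (z l)) *
        MeasureTheory.volume.restrict (Set.univ.pi fun _ : Fin k => Set.Ioo 0 t)
          (jumpPath β S n a t z ⁻¹' A) := by
  simp only [jumpMeasure, MeasureTheory.Measure.coe_finsetSum, Finset.sum_apply,
    MeasureTheory.Measure.smul_apply, smul_eq_mul]
  exact Finset.sum_congr rfl fun z _ => by
    rw [MeasureTheory.Measure.map_apply_of_aemeasurable (aemeasurable_jumpPath n a z) hA]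

instance isFiniteMeasure_uniformTimes (t : ℝ) (k : ℕ) : MeasureTheory.IsFiniteMeasure
    (MeasureTheory.volume.restrict (Set.univ.pi fun _ : Fin k => Set.Ioo 0 t)) := by
  refine ⟨?_⟩
  rw [MeasureTheory.Measure.restrict_apply_univ, MeasureTheory.volume_pi_pi]
  exact ENNReal.prod_lt_top fun i _ => by simp

/-- Summing over the sizes treats all jumps alike, whence a `k`-th power; its base is computed from
the Lévy–Khinchin formula. -/
theorem jumpMeasure_cylinder (hβ : IsUniformizer β) (hS : IsRepSystem S)
    (hχ : IsRankZeroChar β χ) {α : ℝ} (hα : 0 < α) {n : ℕ} (h0 : (0 : K) ∈ grid β S n) {t : ℝ}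
    (ht : 0 ≤ t) (k : ℕ) {N : ℕ} {τ : Fin N → Set.Icc (0 : ℝ) t} (hτ : Monotone τ)
    {a : K} (ha : a ∈ grid β S n) {b : Fin N → K} (hb : ∀ i, b i ∈ grid β S n)
    {σ : Fin (N + 1) → ℝ} (hσ : σ = Fin.cons 0 fun i => (τ i : ℝ)) {b' : Fin (N + 1) → K}
    (hb' : b' = Fin.cons a b) :
    (((jumpMeasure β S χ α n a t k).real {ω | ∀ i, ω.path (τ i) = b i} : ℝ) : ℂ) =
      ((resCard K : ℂ) ^ (2 * n * N))⁻¹ * ∑ y ∈ Fintype.piFinset fun _ : Fin N => grid β S n,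
        (∏ i : Fin N, (χ ((b' i.succ - b' i.castSucc) * y i) : ℂ)) *
          (((∑ z ∈ grid β S n, jumpRate β S χ α n z) * t : ℝ) -
            ∑ i : Fin N, (((σ i.succ - σ i.castSucc) * canonAbs (y i) ^ α : ℝ) : ℂ)) ^ k := by
  classical
  have hreal : (jumpMeasure β S χ α n a t k).real {ω | ∀ i, ω.path (τ i) = b i} =
      ∑ z ∈ Fintype.piFinset fun _ : Fin k => grid β S n, (∏ l, jumpRate β S χ α n (z l)) *
        (MeasureTheory.volume.restrict (Set.univ.pi fun _ : Fin k => Set.Ioo 0 t)).real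
          (jumpPath β S n a t z ⁻¹' {ω | ∀ i, ω.path (τ i) = b i}) := by
    rw [MeasureTheory.measureReal_def, jumpMeasure_apply α n a t k (measurableSet_cylinder hβ τ b),
      ENNReal.toReal_sum fun z _ => ENNReal.mul_ne_top ENNReal.ofReal_ne_top
        (MeasureTheory.measure_ne_top _ _)]
    refine Finset.sum_congr rfl fun z hz => ?_
    rw [ENNReal.toReal_mul, ENNReal.toReal_ofReal, MeasureTheory.measureReal_def]
    exact Finset.prod_nonneg fun l _ =>
      jumpRate_nonneg hβ hS hχ hα h0 (Fintype.mem_piFinset.1 hz l)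
  rw [hreal, Complex.ofReal_sum]
  have hterm : ∀ z ∈ Fintype.piFinset fun _ : Fin k => grid β S n,
      (((∏ l, jumpRate β S χ α n (z l)) *
        (MeasureTheory.volume.restrict (Set.univ.pi fun _ : Fin k => Set.Ioo 0 t)).real
          (jumpPath β S n a t z ⁻¹' {ω | ∀ i, ω.path (τ i) = b i}) : ℝ) : ℂ) =
      ((resCard K : ℂ) ^ (2 * n * N))⁻¹ * ∑ y ∈ Fintype.piFinset fun _ : Fin N => grid β S n,
        (∏ i : Fin N, (χ ((b' i.succ - b' i.castSucc) * y i) : ℂ)) *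
          ∏ l : Fin k, ((jumpRate β S χ α n (z l) : ℂ) *
            (t + ∑ i : Fin N, ((σ i.succ - σ i.castSucc : ℝ) : ℂ) * (χ (-(z l * y i)) - 1))) := by
    intro z hz
    rw [Complex.ofReal_mul, volume_jumpPath_cylinder hβ hS hχ ht (Fintype.mem_piFinset.1 hz) hτ ha
      hb hσ hb', mul_left_comm, Finset.mul_sum]
    congr 1
    refine Finset.sum_congr rfl fun y _ => ?_
    rw [Finset.prod_mul_distrib, Complex.ofReal_prod, mul_left_comm]
  rw [Finset.sum_congr rfl hterm, ← Finset.mul_sum, Finset.sum_comm]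
  congr 1
  refine Finset.sum_congr rfl fun y hy => ?_
  rw [← Finset.mul_sum]
  congr 1
  rw [← Finset.prod_univ_sum (fun _ : Fin k => grid β S n) (fun _ z =>
    (jumpRate β S χ α n z : ℂ) * (t + ∑ i : Fin N, ((σ i.succ - σ i.castSucc : ℝ) : ℂ) *
      (χ (-(z * y i)) - 1))), Finset.prod_const, Finset.card_univ, Fintype.card_fin]
  congr 1
  simp_rw [mul_add, Finset.sum_add_distrib, Finset.mul_sum]
  rw [Finset.sum_comm, sub_eq_add_neg, ← Finset.sum_neg_distrib]
  congr 1
  · push_cast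
    rw [Finset.sum_mul]
  · refine Finset.sum_congr rfl fun i _ => ?_
    rw [Complex.ofReal_mul, ← mul_neg,
      ← sum_jumpRate_mul hβ hS hχ hα h0 (Fintype.mem_piFinset.1 hy i), Finset.mul_sum]
    exact Finset.sum_congr rfl fun z _ => mul_left_comm _ _ _

theorem jumpMeasure_ne_top (α : ℝ) (n : ℕ) (a : K) (t : ℝ) (k : ℕ) {A : Set (SkorokhodSpace K t)}
    (hA : MeasurableSet A) : jumpMeasure β S χ α n a t k A ≠ ⊤ := by
  rw [jumpMeasure_apply α n a t k hA]
  exact ENNReal.sum_ne_top.2 fun z _ => ENNReal.mul_ne_top ENNReal.ofReal_ne_top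
    (MeasureTheory.measure_ne_top _ _)

/-- The finite-dimensional distributions of the compound Poisson process. -/
theorem walkMeasure_cylinder (hβ : IsUniformizer β) (hS : IsRepSystem S)
    (hχ : IsRankZeroChar β χ) {α : ℝ} (hα : 0 < α) {n : ℕ} (h0 : (0 : K) ∈ grid β S n) {t : ℝ}
    (ht : 0 ≤ t) {N : ℕ} {τ : Fin N → Set.Icc (0 : ℝ) t} (hτ : Monotone τ)
    {a : K} (ha : a ∈ grid β S n) {b : Fin N → K} (hb : ∀ i, b i ∈ grid β S n) :
    walkMeasure β S χ α n a t {ω | ∀ i, ω.path (τ i) = b i} ≠ ⊤ ∧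
    (((walkMeasure β S χ α n a t).real {ω | ∀ i, ω.path (τ i) = b i} : ℝ) : ℂ) =
      (∏ i : Fin N, density β S χ α n
        ((τ i : ℝ) - (Fin.cons 0 (fun i => (τ i : ℝ)) : Fin (N + 1) → ℝ) i.castSucc)
        (b i - (Fin.cons a b : Fin (N + 1) → K) i.castSucc)) * ((resCard K : ℂ) ^ (n * N))⁻¹ := by
  classical
  have hAmeas := measurableSet_cylinder hβ τ b
  set A := {ω : SkorokhodSpace K t | ∀ i, ω.path (τ i) = b i} with hA
  set σ : Fin (N + 1) → ℝ := Fin.cons 0 fun i => (τ i : ℝ) with hσ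
  set b' : Fin (N + 1) → K := Fin.cons a b with hb'
  set L : ℝ := (∑ z ∈ grid β S n, jumpRate β S χ α n z) * t with hL
  set ψ : (Fin N → K) → ℂ := fun y =>
    ∑ i : Fin N, (((σ i.succ - σ i.castSucc) * canonAbs (y i) ^ α : ℝ) : ℂ) with hψ
  set c : (Fin N → K) → ℂ := fun y =>
    ∏ i : Fin N, (χ ((b' i.succ - b' i.castSucc) * y i) : ℂ) with hc
  -- `jumpMeasure` has total mass `L^k`, so these are the contributions of the Poisson distribution
  -- with mean `L`.
  set f : ℕ → ℝ := fun k => Real.exp (-L) / k.factorial * (jumpMeasure β S χ α n a t k).real A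
    with hf
  have hf0 : ∀ k, 0 ≤ f k := fun k => by
    simp only [hf]; positivity
  have happly : walkMeasure β S χ α n a t A = ∑' k, ENNReal.ofReal (f k) := by
    rw [walkMeasure, MeasureTheory.Measure.sum_apply _ hAmeas]
    refine tsum_congr fun k => ?_
    simp only [MeasureTheory.Measure.smul_apply, smul_eq_mul, hf]
    rw [ENNReal.ofReal_mul (by positivity), MeasureTheory.measureReal_def,
      ENNReal.ofReal_toReal (jumpMeasure_ne_top α n a t k hAmeas)]
  have hsum : HasSum (fun k => (f k : ℂ)) (((resCard K : ℂ) ^ (2 * n * N))⁻¹ *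
      ∑ y ∈ Fintype.piFinset fun _ : Fin N => grid β S n, c y * Complex.exp (-ψ y)) := by
    have h1 : ∀ k, (f k : ℂ) = ((resCard K : ℂ) ^ (2 * n * N))⁻¹ *
        ∑ y ∈ Fintype.piFinset fun _ : Fin N => grid β S n,
          c y * (Complex.exp (-L) * (((L : ℂ) - ψ y) ^ k / k.factorial)) := by
      intro k
      simp only [hf]
      rw [Complex.ofReal_mul, jumpMeasure_cylinder hβ hS hχ hα h0 ht k hτ ha hb hσ hb',
        mul_left_comm, Finset.mul_sum]
      congr 1
      refine Finset.sum_congr rfl fun y _ => ?_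
      push_cast
      simp only [hψ, hc, hL]
      push_cast
      ring
    simp_rw [h1]
    refine (hasSum_sum fun y _ => ?_).mul_left _
    refine HasSum.mul_left _ ?_
    -- The series in `k` sums to `exp (L - ψ y)`, and the Poisson normalisation `exp (-L)` removes
    -- `L`.
    have h2 : Complex.exp (-ψ y) = Complex.exp (-L) * Complex.exp ((L : ℂ) - ψ y) := by
      rw [← Complex.exp_add]; congr 1; ring
    rw [h2]
    refine HasSum.mul_left _ ?_
    rw [Complex.exp_eq_exp_ℂ]
    exact NormedSpace.expSeries_div_hasSum_exp _
  have hsummable : Summable f := Complex.summable_ofReal.1 hsum.summable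
  rw [happly, ← ENNReal.ofReal_tsum_of_nonneg hf0 hsummable]
  refine ⟨ENNReal.ofReal_ne_top, ?_⟩
  rw [MeasureTheory.measureReal_def, happly, ← ENNReal.ofReal_tsum_of_nonneg hf0 hsummable,
    ENNReal.toReal_ofReal (tsum_nonneg hf0), Complex.ofReal_tsum, hsum.tsum_eq]
  have hdens : ∀ i : Fin N, density β S χ α n ((τ i : ℝ) - σ i.castSucc) (b i - b' i.castSucc) =
      ((resCard K : ℂ) ^ n)⁻¹ * ∑ y ∈ grid β S n,
        Complex.exp (-(((σ i.succ - σ i.castSucc) * canonAbs y ^ α : ℝ) : ℂ)) *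
          χ ((b' i.succ - b' i.castSucc) * y) := by
    intro i
    rw [density, invFourier, hσ, hb', Fin.cons_succ, Fin.cons_succ]
    congr 1
    refine Finset.sum_congr rfl fun y _ => ?_
    rw [neg_mul]
    push_cast
    rfl
  -- The densities supply `q^{-nN}` and the cylinder formula another `q^{-nN}`, matching `q^{-2nN}`
  -- from the character expansion.
  rw [Finset.prod_congr rfl fun i _ => hdens i, Finset.prod_mul_distrib, Finset.prod_const,
    Finset.card_univ, Fintype.card_fin, Finset.prod_univ_sum, inv_pow, ← pow_mul,
    mul_right_comm ((resCard K : ℂ) ^ (n * N))⁻¹, ← mul_inv, ← pow_add]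
  congr 1
  · congr 2; ring
  · refine Finset.sum_congr rfl fun y _ => ?_
    rw [Finset.prod_mul_distrib, ← Complex.exp_sum, Finset.sum_neg_distrib, mul_comm]

end WalkMeasure

/-! ### The compound Poisson law has the required cylinder values -/

section Existence

variable {K : Type*} [Field K] [ValuativeRel K] [TopologicalSpace K]
  [IsNonarchimedeanLocalField K] {β : 𝒪[K]} {S : Finset 𝒪[K]} {χ : AddChar K Circle}

theorem walkMeasure_notMem_grid (hβ : IsUniformizer β) (hS : IsRepSystem S) (α : ℝ) {n : ℕ} {t : ℝ}
    {a : K} (ha : a ∈ grid β S n) (s : Set.Icc (0 : ℝ) t) :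
    walkMeasure β S χ α n a t {ω | ω.path s ∉ grid β S n} = 0 := by
  have hmeas : MeasurableSet {ω : SkorokhodSpace K t | ω.path s ∉ grid β S n} := by
    have : {ω : SkorokhodSpace K t | ω.path s ∉ grid β S n} =
        (⋃ b ∈ grid β S n, {ω : SkorokhodSpace K t | ω.path s = b})ᶜ := by
      ext ω; simp
    rw [this]
    exact (Finset.measurableSet_biUnion _ fun b _ => measurableSet_path_eq hβ s b).compl
  rw [walkMeasure, MeasureTheory.Measure.sum_apply _ hmeas, ENNReal.tsum_eq_zero]
  intro k
  rw [MeasureTheory.Measure.smul_apply, jumpMeasure_apply α n a t k hmeas, smul_eq_mul,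
    mul_eq_zero]
  right
  refine Finset.sum_eq_zero fun z hz => ?_
  have : jumpPath β S n a t z ⁻¹' {ω | ω.path s ∉ grid β S n} = ∅ := by
    ext u
    simp only [Set.mem_preimage, Set.mem_ofPred_eq, Set.mem_empty_iff_false, iff_false, not_not]
    exact (gridRep_spec hβ hS (AddSubgroup.add_mem (ballSubgroup hβ (n : ℤ))
      (grid_subset_ball hβ ha) (jumpSum_mem_ball hβ (Fintype.mem_piFinset.1 hz) u s))).1
  rw [this, MeasureTheory.measure_empty, mul_zero]

theorem isGridWalkMeasure_walkMeasure (hβ : IsUniformizer β) (hS : IsRepSystem S)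
    (hχ : IsRankZeroChar β χ) {α : ℝ} (hα : 0 < α) {n : ℕ} (h0 : (0 : K) ∈ grid β S n) {t : ℝ}
    (ht : 0 ≤ t) {a : K} (ha : a ∈ grid β S n) :
    IsGridWalkMeasure β S χ α n a (walkMeasure β S χ α n a t) where
  isProb := by
    -- The cylinder with no times is the whole space, and its mass is the empty product.
    obtain ⟨h1, h2⟩ := walkMeasure_cylinder hβ hS hχ hα h0 ht (N := 0) (τ := Fin.elim0)
      (fun i => i.elim0) ha (b := Fin.elim0) fun i => i.elim0
    have huniv : {ω : SkorokhodSpace K t | ∀ i : Fin 0, ω.path (Fin.elim0 i) = Fin.elim0 i} =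
        Set.univ := by ext ω; simp
    rw [huniv] at h1 h2
    simp only [Finset.univ_eq_empty, Finset.prod_empty, mul_zero, pow_zero, inv_one, mul_one] at h2
    have h3 : (walkMeasure β S χ α n a t).real Set.univ = 1 := by exact_mod_cast h2
    refine ⟨?_⟩
    rw [← ENNReal.ofReal_toReal h1, ← MeasureTheory.measureReal_def, h3, ENNReal.ofReal_one]
  cylinder N τ hτ J _ := by
    classical
    set B := (Fintype.piFinset fun _ : Fin N => grid β S n).filter fun b => ∀ i, b i ∈ J i with hB
    have hBgrid : ∀ b ∈ B, ∀ i, b i ∈ grid β S n := fun b hb =>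
      Fintype.mem_piFinset.1 (Finset.mem_filter.1 hb).1
    have hgrid : ∀ᵐ ω ∂walkMeasure β S χ α n a t, ∀ i, ω.path (τ i) ∈ grid β S n :=
      MeasureTheory.ae_all_iff.2 fun i => walkMeasure_notMem_grid hβ hS α ha (τ i)
    -- Off a null set the path is on the grid at the given times, so the event is a finite disjoint
    -- union of point cylinders.
    have hae : ({ω : SkorokhodSpace K t | ∀ i, ω.path (τ i) ∈ J i} : Set _)
        =ᵐ[walkMeasure β S χ α n a t]
        (⋃ b ∈ B, {ω : SkorokhodSpace K t | ∀ i, ω.path (τ i) = b i} : Set _) := by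
      rw [Filter.eventuallyEq_set]
      filter_upwards [hgrid] with ω hω
      simp only [Set.mem_iUnion, Set.mem_ofPred_eq, exists_prop]
      constructor
      · intro h
        exact ⟨fun i => ω.path (τ i), Finset.mem_filter.2 ⟨Fintype.mem_piFinset.2 hω, h⟩,
          fun i => rfl⟩
      · rintro ⟨b, hb, h⟩ i
        rw [h i]
        exact (Finset.mem_filter.1 hb).2 i
    rw [MeasureTheory.measureReal_congr hae, MeasureTheory.measureReal_biUnion_finset
      (fun b _ b' _ hbb' => Set.disjoint_left.2 fun ω h h' =>
        hbb' (funext fun i => (h i).symm.trans (h' i)))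
      (fun b _ => measurableSet_cylinder hβ τ b)
      (fun b hb => (walkMeasure_cylinder hβ hS hχ hα h0 ht hτ.monotone ha (hBgrid b hb)).1),
      Complex.ofReal_sum, cylinderMass]
    exact Finset.sum_congr rfl fun b hb =>
      (walkMeasure_cylinder hβ hS hχ hα h0 ht hτ.monotone ha (hBgrid b hb)).2

end Existence

/-! ### Paths stay on the grid almost surely -/

section FullMeasure

/-- A Skorokhod path that visits a closed set at the end and at a dense set of times stays there. -/
theorem SkorokhodSpace.forall_mem_of_dense {K : Type*} [TopologicalSpace K] {t : ℝ}
    (ω : SkorokhodSpace K t) {F : Set K}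
    (hF : IsClosed F) {D : Set (Set.Icc (0 : ℝ) t)} (hD : Dense D)
    (hωD : ∀ s ∈ D, ω.path s ∈ F) (hωt : ∀ s : Set.Icc (0 : ℝ) t, (s : ℝ) = t → ω.path s ∈ F)
    (s : Set.Icc (0 : ℝ) t) : ω.path s ∈ F := by
  by_cases hs : (s : ℝ) = t
  · exact hωt s hs
  have hst : (s : ℝ) < t := lt_of_le_of_ne s.2.2 hs
  have hgt : ∃ r, s < r := ⟨⟨t, s.2.1.trans s.2.2, le_rfl⟩, hst⟩
  refine hF.mem_of_frequently_of_tendsto ?_ (ω.rightCont s)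
  rw [Filter.frequently_iff]
  intro U hU
  obtain ⟨v, hv, hsub⟩ := (mem_nhdsGT_iff_exists_Ioo_subset' hgt.choose_spec).1 hU
  obtain ⟨r, hrD, hr⟩ := hD.exists_between hv
  exact ⟨r, hsub hr, hωD r hrD⟩

variable {K : Type*} [Field K] [ValuativeRel K] [TopologicalSpace K]
  [IsNonarchimedeanLocalField K] {β : 𝒪[K]} {S : Finset 𝒪[K]} {χ : AddChar K Circle}

theorem isClosed_finset (hβ : IsUniformizer β) (F : Finset K) : IsClosed (F : Set K) := by
  have hs : ∀ b : K, IsClosed {b} := by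
    intro b
    rw [← isOpen_compl_iff, isOpen_iff_mem_nhds]
    intro x hx
    have hpos := canonAbs_pos (sub_ne_zero.2 (Ne.symm hx))
    filter_upwards [canonAbs_lt_mem_nhds hβ hpos x] with y hy hyb
    rw [Set.mem_singleton_iff] at hyb
    rw [hyb] at hy
    exact lt_irrefl _ hy
  have : (F : Set K) = ⋃ b ∈ F, {b} := by ext; simp
  rw [this]
  exact F.finite_toSet.isClosed_biUnion fun b _ => hs b

theorem cylinderMass_eq_zero (α : ℝ) {n : ℕ} (a : K) {N : ℕ} (τ : Fin N → ℝ) {J : Fin N → Set K}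
    (i : Fin N) (hJ : Disjoint (J i) (grid β S n)) : cylinderMass β S χ α n a τ J = 0 := by
  classical
  refine Finset.sum_eq_zero fun b hb => ?_
  rw [Finset.mem_filter, Fintype.mem_piFinset] at hb
  exact absurd (hb.1 i) (Set.disjoint_left.1 hJ (hb.2 i))

/-- One-time marginals suffice: they put no mass off the grid, and countably many times determine
whether a path stays in a closed set. -/
theorem IsGridWalkMeasure.measure_forall_mem_grid (hβ : IsUniformizer β) {α : ℝ} {n : ℕ} {a : K}
    {t : ℝ} {P : MeasureTheory.Measure (SkorokhodSpace K t)}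
    (hP : IsGridWalkMeasure β S χ α n a P) : P {ω | ∀ s, ω.path s ∈ grid β S n} = 1 := by
  have := hP.isProb
  have hclosed := isClosed_finset hβ (grid β S n)
  have hnull : ∀ s, P {ω | ω.path s ∉ grid β S n} = 0 := by
    intro s
    have h := hP.cylinder 1 (fun _ => s) (Subsingleton.strictMono _)
      (fun _ => (grid β S n : Set K)ᶜ) fun _ =>
        MeasurableSpace.measurableSet_generateFrom hclosed.isOpen_compl
    have hmass : cylinderMass β S χ α n a (fun _ : Fin 1 => (s : ℝ))
        (fun _ => (grid β S n : Set K)ᶜ) = 0 :=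
      cylinderMass_eq_zero α a _ 0 disjoint_compl_left
    rw [hmass, Complex.ofReal_eq_zero, MeasureTheory.measureReal_eq_zero_iff] at h
    convert h using 2
    ext ω
    simp
  obtain ⟨D, hDc, hD⟩ := TopologicalSpace.exists_countable_dense (Set.Icc (0 : ℝ) t)
  have hae : ∀ᵐ ω ∂P, ∀ s, ω.path s ∈ grid β S n := by
    have h1 : ∀ᵐ ω ∂P, ∀ s ∈ D, ω.path s ∈ grid β S n :=
      (MeasureTheory.ae_ball_iff hDc).2 fun s _ => hnull s
    -- The end time has no times to its right and need not belong to `D`, so it is handled by its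
    -- own marginal.
    have h2 : ∀ᵐ ω ∂P, ∀ s : Set.Icc (0 : ℝ) t, (s : ℝ) = t → ω.path s ∈ grid β S n := by
      by_cases ht : 0 ≤ t
      · have := hnull ⟨t, ht, le_rfl⟩
        filter_upwards [MeasureTheory.ae_iff.2 this] with ω hω s hs
        rwa [show s = ⟨t, ht, le_rfl⟩ from Subtype.ext hs]
      · exact Filter.Eventually.of_forall fun ω s => absurd (s.2.1.trans s.2.2) ht
    filter_upwards [h1, h2] with ω hω1 hω2 s
    exact ω.forall_mem_of_dense hclosed hD hω1 hω2 s
  rw [MeasureTheory.measure_congr (Filter.eventuallyEq_univ.2 hae), MeasureTheory.measure_univ]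

end FullMeasure

end LocalFieldWalk

end

theorem mainTheorem12 {K : Type*} [Field K] [ValuativeRel K] [TopologicalSpace K]
    [IsNonarchimedeanLocalField K]
    (β : 𝒪[K]) (hβ : LocalFieldWalk.IsUniformizer β)
    (S : Finset 𝒪[K]) (hS : LocalFieldWalk.IsRepSystem S)
    (χ : AddChar K Circle) (hχ : LocalFieldWalk.IsRankZeroChar β χ)
    (α : ℝ) (hα : 0 < α) (t : ℝ) (ht : 0 < t) (n : ℕ) (hn : 0 < n)
    (h0 : (0 : K) ∈ LocalFieldWalk.grid β S n)
    (a : K) (ha : a ∈ LocalFieldWalk.grid β S n) :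
    (∃ P : MeasureTheory.Measure (LocalFieldWalk.SkorokhodSpace K t),
      LocalFieldWalk.IsGridWalkMeasure β S χ α n a P) ∧
    ∀ P : MeasureTheory.Measure (LocalFieldWalk.SkorokhodSpace K t),
      LocalFieldWalk.IsGridWalkMeasure β S χ α n a P →
        P {ω | ∀ s, ω.path s ∈ LocalFieldWalk.grid β S n} = 1 :=
  ⟨⟨_, LocalFieldWalk.isGridWalkMeasure_walkMeasure hβ hS hχ hα h0 ht.le ha⟩,
    fun _ hP => hP.measure_forall_mem_grid hβ⟩
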